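/- Let $S$ be a Riemann surface homeomorphic to the 2-sphere, let $p_1,\dots,p_m\in S$ be distinct points, and let $X:S\setminus\{p_1,\dots,p_m\}\to\mathbb R^3$ be a complete, conformally parametrized, immersed minimal surface all of whose ends are embedded and planar; that is, for each $i$ we have $|X(x)|\to\infty$ as $x\to p_i$, and $X$ maps some punctured neighbourhood of $p_i$ injectively onto the graph, over the complement of a disc in an affine plane $A_i\subset\mathbb R^3$ (the asymptotic plane), of a smooth function that tends to $0$ at infinity. Suppose that $X$ is spiny, that is, the asymptotic planes $A_1,\dots,A_m$ meet at a point $q\in\mathbb R^3$. Let $\nu$ be the Gauss map of $X$ and $g$ the metric induced by $X$. Then the support function with respect to $q$, $$u=(X-q)\cdot\nu$$ (which is $X\cdot\nu$ once $X$ has been translated so that $q=0$), is a bounded Jacobi field for the area functional: $u$ is smooth and bounded on $S\setminus\{p_1,\dots,p_m\}$ and satisfies $Lu=\Delta_g u+|\nabla\nu|_g^2\,u=0$ there. Moreover, $u$ extends to a smooth function on all of $S$, and the extension satisfies $u(p_i)=0$ for $i=1,\dots,m$. -/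

import Mathlib

open Set Filter Topology
open scoped ContDiff Manifold RealInnerProductSpace

noncomputable section

namespace PlanarEnds

/-- Euclidean three-space. -/
abbrev E3 : Type := EuclideanSpace ℝ (Fin 3)

/-! ### Surfaces in a conformal coordinate `z = x + i y`

Here `f : ℂ → E3` is a parametrised surface, and all notions are evaluated at a point `z`. The
first and second order operators `jacobiOp` and `meanCurv` are only used where `f` is a conformal
immersion; there the induced metric is `λ (dx² + dy²)` with `λ = ‖∂f/∂x‖²`, hence its
Laplace-Beltrami operator is `λ⁻¹ (∂²/∂x² + ∂²/∂y²)`, and its squared gradient norm is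
`λ⁻¹ (|∂/∂x|² + |∂/∂y|²)`. -/

/-- The partial derivative `∂f/∂x`. -/
def dX {F : Type*} [NormedAddCommGroup F] [NormedSpace ℝ F] (f : ℂ → F) (z : ℂ) : F :=
  fderiv ℝ f z 1

/-- The partial derivative `∂f/∂y`. -/
def dY {F : Type*} [NormedAddCommGroup F] [NormedSpace ℝ F] (f : ℂ → F) (z : ℂ) : F :=
  fderiv ℝ f z Complex.I

/-- `f` is a conformal immersion at `z`. -/
def IsConformalImmersionAt (f : ℂ → E3) (z : ℂ) : Prop :=
  dX f z ≠ 0 ∧ ‖dX f z‖ = ‖dY f z‖ ∧ ⟪dX f z, dY f z⟫ = 0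

/-- The cross product of `E3`. -/
def cross (v w : E3) : E3 := WithLp.toLp 2 (crossProduct (WithLp.ofLp v) (WithLp.ofLp w))

/-- The unit normal `(∂f/∂x × ∂f/∂y) / |∂f/∂x × ∂f/∂y|`. -/
def unitNormal (f : ℂ → E3) (z : ℂ) : E3 :=
  ‖cross (dX f z) (dY f z)‖⁻¹ • cross (dX f z) (dY f z)

/-- The mean curvature (half of the trace of the second fundamental form with respect to the
induced metric). -/
def meanCurv (f : ℂ → E3) (z : ℂ) : ℝ :=
  ⟪Laplacian.laplacian f z, unitNormal f z⟫ / (2 * ‖dX f z‖ ^ 2)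

/-- The Jacobi operator `L v = Δ_g v + |∇ν|²_g v` of the area functional, where `g` is the metric
induced by `f` and `ν` is the unit normal of `f`. -/
def jacobiOp (f : ℂ → E3) (v : ℂ → ℝ) (z : ℂ) : ℝ :=
  (Laplacian.laplacian v z
    + (‖dX (unitNormal f) z‖ ^ 2 + ‖dY (unitNormal f) z‖ ^ 2) * v z) / ‖dX f z‖ ^ 2

/-! ### Surfaces parametrised over a punctured Riemann surface

`S` is a Riemann surface, `P` the set of punctures. Maps are defined on all of `S`, but the values
of a surface `X` at points of `P` are never used. -/

section Surface

variable {S : Type*} [TopologicalSpace S] [ChartedSpace ℂ S]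

/-- The holomorphic coordinates of `S`. -/
def holCharts (S : Type*) [TopologicalSpace S] [ChartedSpace ℂ S] :
    Set (OpenPartialHomeomorph S ℂ) :=
  IsManifold.maximalAtlas 𝓘(ℂ) ω S

/-- The restriction of `f` to the open set `U` is smooth (in the real sense). -/
def IsSmoothOn {F : Type*} [NormedAddCommGroup F] [NormedSpace ℝ F] (f : S → F) (U : Set S) :
    Prop :=
  ∀ e ∈ holCharts S, ContDiffOn ℝ ∞ (f ∘ e.symm) (e.target ∩ e.symm ⁻¹' U)

/-- The Gauss map of `X`, computed in a holomorphic coordinate around the point in question.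
(Its value does not depend on this coordinate, because holomorphic coordinate changes preserve
the orientation.) -/
def gaussMap (X : S → E3) (x : S) : E3 :=
  unitNormal (X ∘ (chartAt ℂ x).symm) (chartAt ℂ x x)

/-- The metric induced by `X` on `S \ P` is complete: every curve in `S \ P` that leaves all compact
subsets of `S \ P` has infinite length. -/
def IsCompleteOff (X : S → E3) (P : Set S) : Prop :=
  ∀ γ : ℝ → S, ContinuousOn γ (Ico 0 1) → MapsTo γ (Ico 0 1) Pᶜ →
    (∀ K : Set S, IsCompact K → K ⊆ Pᶜ → ∀ᶠ t in 𝓝[<] (1 : ℝ), γ t ∉ K) →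
    eVariationOn (X ∘ γ) (Ico 0 1) = ⊤

/-- `X : S \ P → E3` is a complete, conformally parametrised, immersed minimal surface. -/
structure IsCompleteMinimal (X : S → E3) (P : Set S) : Prop where
  smooth : IsSmoothOn X Pᶜ
  conformal : ∀ e ∈ holCharts S, ∀ z ∈ e.target, e.symm z ∉ P →
    IsConformalImmersionAt (X ∘ e.symm) z
  minimal : ∀ e ∈ holCharts S, ∀ z ∈ e.target, e.symm z ∉ P → meanCurv (X ∘ e.symm) z = 0
  complete : IsCompleteOff X P

/-- The end of `X : S \ P → E3` at the puncture `p` is embedded and planar, with asymptotic plane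
`A`: as `x → p` the surface goes to infinity, and `X` maps some punctured neighbourhood of `p`
injectively onto the graph, over the complement of a disc in the plane `A = o + ι(ℂ)`, of a smooth
function that tends to `0` at infinity. -/
def IsEmbeddedPlanarEnd (X : S → E3) (P : Set S) (p : S) (A : AffineSubspace ℝ E3) : Prop :=
  Tendsto X (𝓝[≠] p) (cocompact E3) ∧
  ∃ (o n : E3) (ι : ℂ →ₗᵢ[ℝ] E3) (h : ℂ → ℝ) (R : ℝ) (U : Set S),
    A = AffineSubspace.mk' o (LinearMap.range ι.toLinearMap) ∧
    ‖n‖ = 1 ∧ (∀ ζ, ⟪ι ζ, n⟫ = 0) ∧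
    ContDiff ℝ ∞ h ∧ Tendsto h (cocompact ℂ) (𝓝 0) ∧ 0 < R ∧
    IsOpen U ∧ p ∈ U ∧ Disjoint (U \ {p}) P ∧
    InjOn X (U \ {p}) ∧
    X '' (U \ {p}) = {y | ∃ ζ : ℂ, R < ‖ζ‖ ∧ y = o + ι ζ + h ζ • n}

/-- `X : S \ {p₁, …, pₘ} → E3` is a complete minimal surface whose ends are embedded and planar,
with asymptotic planes `A₁, …, Aₘ`. -/
structure IsCompleteMinimalWithPlanarEnds {m : ℕ} (X : S → E3) (p : Fin m → S)
    (A : Fin m → AffineSubspace ℝ E3) : Prop where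
  isCompleteMinimal : IsCompleteMinimal X (range p)
  planarEnd : ∀ i, IsEmbeddedPlanarEnd X (range p) (p i) (A i)

/-- A surface with asymptotic planes `A₁, …, Aₘ` is spiny, with centre `q`: the asymptotic planes
meet at the point `q`. -/
def IsSpinyAt {m : ℕ} (A : Fin m → AffineSubspace ℝ E3) (q : E3) : Prop :=
  ∀ i, q ∈ A i

/-- The function `u` on `S \ P` is a bounded Jacobi field of `X : S \ P → E3` for the area
functional. -/
structure IsBoundedJacobiField (X : S → E3) (P : Set S) (u : S → ℝ) : Prop where
  smooth : IsSmoothOn u Pᶜ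
  jacobi : ∀ e ∈ holCharts S, ∀ z ∈ e.target, e.symm z ∉ P →
    jacobiOp (X ∘ e.symm) (u ∘ e.symm) z = 0
  bounded : ∃ C : ℝ, ∀ x ∉ P, |u x| ≤ C

end Surface

end PlanarEnds

end

/-! Away from the punctures the claim is local. In a conformal coordinate a minimal immersion `f` is
harmonic (`laplace_eq_zero`). Its shape operator is trace free, which gives `ΔN = -|∇N|² N` for the
unit normal `N` and makes the cross term `⟪f_x, N_x⟫ + ⟪f_y, N_y⟫` vanish (`laplace_unitNormal`).
The product rule for `Δ⟪f - q, N⟫` then leaves only `-|∇N|² u`.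

At a puncture `c`, take orthonormal coordinates `x₁, x₂, x₃` centred at `q`, with `x₃` normal to the
asymptotic plane. Since `q` lies in that plane, `x₃` is exactly the graph function and tends to `0`;
this is where spininess enters. A harmonic function with limit `0` at an isolated singularity is `Re
Φ` with `Φ` holomorphic across it.

Write `φⱼ = 2 ∂xⱼ/∂z`, `a = φ₁ + iφ₂`, `b = φ₁ - iφ₂`, `G = φ₃ / a`. Conformality says `ab = -φ₃²`.
The projection of the graph to its plane is a local diffeomorphism, so after a possible reflection
`|b| < |a|`; hence `|G| < 1` and `G` extends holomorphically. The normal is, up to a constant sign,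
`(-2 Re G, 2 Im G, 1 - |G|²) / (1 + |G|²)`, so with `F = x₁ + i x₂` the support function is `±(-2
Re(FG) + x₃ (1 - |G|²)) / (1 + |G|²)`.

Only the product `FG` is delicate, because `F` blows up. As `b = -φ₃G` extends holomorphically, it
has a primitive: choose `B` with `B' = b/2` and `B(c) = 0`. Then `H = F - conj B` is holomorphic
with `H' = a/2`, and it has a pole, so `H = Q H'` with `Q` holomorphic and `Q(c) = 0`. Therefore `FG
= Q φ₃/2 + G conj B`, which is smooth and vanishes at `c` (`exists_contDiffAt_extension`).
Boundedness follows from compactness of the sphere. -/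

namespace PlanarEnds

/-! ### Partial derivatives and the Laplacian of smooth maps on open subsets of the plane -/

section Calculus

variable {F : Type*} [NormedAddCommGroup F] [NormedSpace ℝ F] {W : Set ℂ} {z : ℂ}

theorem contDiffOn_fderiv_apply (hW : IsOpen W) {f : ℂ → F} (hf : ContDiffOn ℝ ∞ f W) (v : ℂ) :
    ContDiffOn ℝ ∞ (fun z => fderiv ℝ f z v) W :=
  (hf.fderiv_of_isOpen hW (m := ∞) (by simp)).clm_apply contDiffOn_const

theorem contDiffOn_dX (hW : IsOpen W) {f : ℂ → F} (hf : ContDiffOn ℝ ∞ f W) :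
    ContDiffOn ℝ ∞ (dX f) W := contDiffOn_fderiv_apply hW hf 1

theorem contDiffOn_dY (hW : IsOpen W) {f : ℂ → F} (hf : ContDiffOn ℝ ∞ f W) :
    ContDiffOn ℝ ∞ (dY f) W := contDiffOn_fderiv_apply hW hf Complex.I

theorem differentiableAt_of_smooth (hW : IsOpen W) {f : ℂ → F} (hf : ContDiffOn ℝ ∞ f W)
    (hz : z ∈ W) : DifferentiableAt ℝ f z :=
  (hf.contDiffAt (hW.mem_nhds hz)).differentiableAt (by simp)

theorem fderiv_fderiv_apply (hW : IsOpen W) {f : ℂ → F} (hf : ContDiffOn ℝ ∞ f W) (hz : z ∈ W)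
    (v w : ℂ) : fderiv ℝ (fun z => fderiv ℝ f z v) z w = fderiv ℝ (fderiv ℝ f) z w v := by
  have h : DifferentiableAt ℝ (fderiv ℝ f) z :=
    ((hf.fderiv_of_isOpen hW (m := ∞) (by simp)).contDiffAt (hW.mem_nhds hz)).differentiableAt
      (by simp)
  rw [fderiv_clm_apply h (differentiableAt_const v)]
  simp

theorem dX_dY (hW : IsOpen W) {f : ℂ → F} (hf : ContDiffOn ℝ ∞ f W) (hz : z ∈ W) :
    dX (dY f) z = dY (dX f) z := by
  have h := (hf.contDiffAt (hW.mem_nhds hz)).isSymmSndFDerivAt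
    (by simpa using (WithTop.coe_le_coe.2 le_top : ((2 : ℕ∞) : ℕ∞ω) ≤ ((⊤ : ℕ∞) : ℕ∞ω)))
  exact (fderiv_fderiv_apply hW hf hz _ _).trans
    ((h.eq _ _).trans (fderiv_fderiv_apply hW hf hz _ _).symm)

theorem laplacian_eq (hW : IsOpen W) {f : ℂ → F} (hf : ContDiffOn ℝ ∞ f W) (hz : z ∈ W) :
    Laplacian.laplacian f z = dX (dX f) z + dY (dY f) z := by
  rw [InnerProductSpace.laplacian_eq_iteratedFDeriv_complexPlane]
  simp only [iteratedFDeriv_two_apply]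
  exact congrArg₂ _ (fderiv_fderiv_apply hW hf hz _ _).symm (fderiv_fderiv_apply hW hf hz _ _).symm

theorem fderiv_congr_of_isOpen (hW : IsOpen W) {f g : ℂ → F} (h : EqOn f g W) (hz : z ∈ W) :
    fderiv ℝ f z = fderiv ℝ g z :=
  (Filter.eventuallyEq_of_mem (hW.mem_nhds hz) h).fderiv_eq

end Calculus

/-! ### Leibniz rules for inner products -/

section Inner

variable {E : Type*} [NormedAddCommGroup E] [InnerProductSpace ℝ E] {W : Set ℂ} {z : ℂ}

theorem dX_inner (hW : IsOpen W) {f g : ℂ → E} (hf : ContDiffOn ℝ ∞ f W)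
    (hg : ContDiffOn ℝ ∞ g W) (hz : z ∈ W) :
    dX (fun z => ⟪f z, g z⟫) z = ⟪f z, dX g z⟫ + ⟪dX f z, g z⟫ :=
  fderiv_inner_apply ℝ (differentiableAt_of_smooth hW hf hz) (differentiableAt_of_smooth hW hg hz) _

theorem dY_inner (hW : IsOpen W) {f g : ℂ → E} (hf : ContDiffOn ℝ ∞ f W)
    (hg : ContDiffOn ℝ ∞ g W) (hz : z ∈ W) :
    dY (fun z => ⟪f z, g z⟫) z = ⟪f z, dY g z⟫ + ⟪dY f z, g z⟫ :=
  fderiv_inner_apply ℝ (differentiableAt_of_smooth hW hf hz) (differentiableAt_of_smooth hW hg hz) _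

/-- Used to differentiate identities such as `|f_x|² = |f_y|²` and `⟪N, f_x⟫ = 0`. -/
theorem dX_inner_congr (hW : IsOpen W) {f g h k : ℂ → E} (hf : ContDiffOn ℝ ∞ f W)
    (hg : ContDiffOn ℝ ∞ g W) (hh : ContDiffOn ℝ ∞ h W) (hk : ContDiffOn ℝ ∞ k W)
    (heq : ∀ z ∈ W, ⟪f z, g z⟫ = ⟪h z, k z⟫) (hz : z ∈ W) :
    ⟪f z, dX g z⟫ + ⟪dX f z, g z⟫ = ⟪h z, dX k z⟫ + ⟪dX h z, k z⟫ := by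
  rw [← dX_inner hW hf hg hz, ← dX_inner hW hh hk hz]
  exact congrArg (· 1) (fderiv_congr_of_isOpen hW heq hz)

theorem dY_inner_congr (hW : IsOpen W) {f g h k : ℂ → E} (hf : ContDiffOn ℝ ∞ f W)
    (hg : ContDiffOn ℝ ∞ g W) (hh : ContDiffOn ℝ ∞ h W) (hk : ContDiffOn ℝ ∞ k W)
    (heq : ∀ z ∈ W, ⟪f z, g z⟫ = ⟪h z, k z⟫) (hz : z ∈ W) :
    ⟪f z, dY g z⟫ + ⟪dY f z, g z⟫ = ⟪h z, dY k z⟫ + ⟪dY h z, k z⟫ := by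
  rw [← dY_inner hW hf hg hz, ← dY_inner hW hh hk hz]
  exact congrArg (· Complex.I) (fderiv_congr_of_isOpen hW heq hz)

theorem laplacian_inner (hW : IsOpen W) {f g : ℂ → E} (hf : ContDiffOn ℝ ∞ f W)
    (hg : ContDiffOn ℝ ∞ g W) (hz : z ∈ W) :
    Laplacian.laplacian (fun z => ⟪f z, g z⟫) z =
      ⟪dX (dX f) z + dY (dY f) z, g z⟫ + 2 * (⟪dX f z, dX g z⟫ + ⟪dY f z, dY g z⟫)
        + ⟪f z, dX (dX g) z + dY (dY g) z⟫ := by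
  rw [laplacian_eq hW (hf.inner ℝ hg) hz]
  have hx : dX (dX fun z => ⟪f z, g z⟫) z =
      dX (fun z => ⟪f z, dX g z⟫ + ⟪dX f z, g z⟫) z :=
    congrArg (· 1) (fderiv_congr_of_isOpen hW (fun w hw => dX_inner hW hf hg hw) hz)
  have hy : dY (dY fun z => ⟪f z, g z⟫) z =
      dY (fun z => ⟪f z, dY g z⟫ + ⟪dY f z, g z⟫) z :=
    congrArg (· Complex.I) (fderiv_congr_of_isOpen hW (fun w hw => dY_inner hW hf hg hw) hz)
  have hfx := contDiffOn_dX hW hf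
  have hfy := contDiffOn_dY hW hf
  have hgx := contDiffOn_dX hW hg
  have hgy := contDiffOn_dY hW hg
  have hx' : dX (fun z => ⟪f z, dX g z⟫ + ⟪dX f z, g z⟫) z =
      dX (fun z => ⟪f z, dX g z⟫) z + dX (fun z => ⟪dX f z, g z⟫) z := by
    exact congrArg (· 1) (fderiv_fun_add (differentiableAt_of_smooth hW (hf.inner ℝ hgx) hz)
      (differentiableAt_of_smooth hW (hfx.inner ℝ hg) hz))
  have hy' : dY (fun z => ⟪f z, dY g z⟫ + ⟪dY f z, g z⟫) z =
      dY (fun z => ⟪f z, dY g z⟫) z + dY (fun z => ⟪dY f z, g z⟫) z := by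
    exact congrArg (· Complex.I) (fderiv_fun_add (differentiableAt_of_smooth hW (hf.inner ℝ hgy) hz)
      (differentiableAt_of_smooth hW (hfy.inner ℝ hg) hz))
  rw [hx, hy, hx', hy', dX_inner hW hf hgx hz, dX_inner hW hfx hg hz, dY_inner hW hf hgy hz,
    dY_inner hW hfy hg hz, inner_add_left, inner_add_right]
  ring

end Inner

/-! ### Cross products and the unit normal -/

section Cross

theorem inner_cross_self_left (v w : E3) : ⟪cross v w, v⟫ = 0 := by
  simp [cross, crossProduct, Fin.sum_univ_three, PiLp.inner_apply]
  ring

theorem inner_cross_self_right (v w : E3) : ⟪cross v w, w⟫ = 0 := by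
  simp [cross, crossProduct, Fin.sum_univ_three, PiLp.inner_apply]
  ring

theorem inner_cross_cross (v w : E3) :
    ⟪cross v w, cross v w⟫ = ⟪v, v⟫ * ⟪w, w⟫ - ⟪v, w⟫ ^ 2 := by
  simp [-inner_self_eq_norm_sq_to_K, cross, crossProduct,
    Fin.sum_univ_three, PiLp.inner_apply]
  ring

theorem cross_cross (u v w : E3) :
    cross u (cross v w) = ⟪u, w⟫ • v - ⟪u, v⟫ • w := by
  ext i
  fin_cases i <;> simp [cross, crossProduct, Fin.sum_univ_three, PiLp.inner_apply] <;> ring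

theorem cross_linear_comb (v w : E3) (α β : ℝ) :
    cross (α • v + β • w) (-β • v + α • w) = (α ^ 2 + β ^ 2) • cross v w := by
  ext i
  fin_cases i <;> simp [cross, crossProduct] <;> ring

theorem contDiffOn_cross {W : Set ℂ} {f g : ℂ → E3} (hf : ContDiffOn ℝ ∞ f W)
    (hg : ContDiffOn ℝ ∞ g W) : ContDiffOn ℝ ∞ (fun z => cross (f z) (g z)) W := by
  rw [contDiffOn_euclidean] at hf hg ⊢
  intro i
  fin_cases i <;> simp [cross, crossProduct] <;>
    exact ((hf _).mul (hg _)).sub ((hf _).mul (hg _))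

variable {f : ℂ → E3} {z : ℂ}

theorem IsConformalImmersionAt.cross_ne_zero (h : IsConformalImmersionAt f z) :
    cross (dX f z) (dY f z) ≠ 0 := by
  obtain ⟨h1, h2, h3⟩ := h
  intro h0
  have := inner_cross_cross (dX f z) (dY f z)
  rw [h0, h3, real_inner_self_eq_norm_sq (dX f z), real_inner_self_eq_norm_sq (dY f z), ← h2] at this
  simp [h1] at this

theorem IsConformalImmersionAt.inner_unitNormal_self (h : IsConformalImmersionAt f z) :
    ⟪unitNormal f z, unitNormal f z⟫ = 1 := by
  have := norm_ne_zero_iff.2 h.cross_ne_zero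
  rw [unitNormal, inner_smul_left, inner_smul_right, real_inner_self_eq_norm_sq]
  simp
  field_simp

theorem inner_unitNormal_dX : ⟪unitNormal f z, dX f z⟫ = 0 := by
  rw [unitNormal, inner_smul_left, inner_cross_self_left, mul_zero]

theorem inner_unitNormal_dY : ⟪unitNormal f z, dY f z⟫ = 0 := by
  rw [unitNormal, inner_smul_left, inner_cross_self_right, mul_zero]

/-- With `w = f_x × f_y`, the triple product formula gives `v × w = 0`; since also `v ⟂ w`,
Lagrange's identity gives `|v| |w| = 0`. Vector identities below are proved by testing against this
frame. -/
theorem IsConformalImmersionAt.eq_zero_of_inner (h : IsConformalImmersionAt f z) {v : E3}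
    (hx : ⟪v, dX f z⟫ = 0) (hy : ⟪v, dY f z⟫ = 0) (hn : ⟪v, unitNormal f z⟫ = 0) : v = 0 := by
  have hc := norm_ne_zero_iff.2 h.cross_ne_zero
  have h1 : ⟪v, cross (dX f z) (dY f z)⟫ = 0 := by
    simpa [unitNormal, inner_smul_right, hc, h.cross_ne_zero] using hn
  have h2 : cross v (cross (dX f z) (dY f z)) = 0 := by simp [cross_cross, hx, hy]
  have h3 := inner_cross_cross v (cross (dX f z) (dY f z))
  rw [h2, h1] at h3
  simpa [h.cross_ne_zero] using h3

theorem contDiffOn_unitNormal {W : Set ℂ} (hW : IsOpen W) (hf : ContDiffOn ℝ ∞ f W)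
    (hc : ∀ z ∈ W, IsConformalImmersionAt f z) : ContDiffOn ℝ ∞ (unitNormal f) W := by
  have h := contDiffOn_cross (contDiffOn_dX hW hf) (contDiffOn_dY hW hf)
  exact ((h.norm ℝ fun z hz => (hc z hz).cross_ne_zero).inv
    fun z hz => norm_ne_zero_iff.2 (hc z hz).cross_ne_zero).smul h

end Cross

/-! ### Harmonicity of the immersion and of its Gauss map; the Jacobi equation -/

section Jacobi

variable {f : ℂ → E3} {W : Set ℂ} {z : ℂ}

/-- These are the first derivatives of `|f_x|² = |f_y|²` and `⟪f_x, f_y⟫ = 0`. They make the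
tangential part of `f_xx + f_yy` vanish. -/
theorem conformal_derivatives (hW : IsOpen W) (hf : ContDiffOn ℝ ∞ f W)
    (hc : ∀ z ∈ W, IsConformalImmersionAt f z) (hz : z ∈ W) :
    ⟪dX (dX f) z, dX f z⟫ = ⟪dY (dX f) z, dY f z⟫ ∧
    ⟪dY (dX f) z, dX f z⟫ = ⟪dY (dY f) z, dY f z⟫ ∧
    ⟪dX (dX f) z, dY f z⟫ + ⟪dY (dX f) z, dX f z⟫ = 0 ∧
    ⟪dY (dX f) z, dY f z⟫ + ⟪dY (dY f) z, dX f z⟫ = 0 := by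
  have hfx := contDiffOn_dX hW hf
  have hfy := contDiffOn_dY hW hf
  have hn : ∀ z ∈ W, ⟪dX f z, dX f z⟫ = ⟪dY f z, dY f z⟫ := fun z hz => by
    rw [real_inner_self_eq_norm_sq, real_inner_self_eq_norm_sq, (hc z hz).2.1]
  have ho : ∀ z ∈ W, ⟪dX f z, dY f z⟫ = ⟪(0 : E3), 0⟫ := fun z hz => by
    rw [(hc z hz).2.2, inner_zero_left]
  have a1 := dX_inner_congr hW hfx hfx hfy hfy hn hz
  have a2 := dY_inner_congr hW hfx hfx hfy hfy hn hz
  have a3 := dX_inner_congr hW hfx hfy contDiffOn_const contDiffOn_const ho hz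
  have a4 := dY_inner_congr hW hfx hfy contDiffOn_const contDiffOn_const ho hz
  rw [dX_dY hW hf hz] at a1 a3
  simp only [inner_zero_left, inner_zero_right, add_zero] at a3 a4
  rw [real_inner_comm (dX (dX f) z) (dX f z), real_inner_comm (dY (dX f) z) (dY f z)] at a1
  rw [real_inner_comm (dY (dX f) z) (dX f z), real_inner_comm (dY (dY f) z) (dY f z)] at a2
  rw [real_inner_comm (dY (dX f) z) (dX f z)] at a3
  rw [real_inner_comm (dY (dY f) z) (dX f z)] at a4
  refine ⟨?_, ?_, ?_, ?_⟩ <;> linarith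

/-- A minimal conformal immersion is harmonic. -/
theorem laplace_eq_zero (hW : IsOpen W) (hf : ContDiffOn ℝ ∞ f W)
    (hc : ∀ z ∈ W, IsConformalImmersionAt f z) (hm : ∀ z ∈ W, meanCurv f z = 0) (hz : z ∈ W) :
    dX (dX f) z + dY (dY f) z = 0 := by
  obtain ⟨a1, a2, a3, a4⟩ := conformal_derivatives hW hf hc hz
  apply (hc z hz).eq_zero_of_inner
  · rw [inner_add_left]
    linarith
  · rw [inner_add_left]
    linarith
  · have := hm z hz
    rw [meanCurv, laplacian_eq hW hf hz] at this
    have hx : ‖dX f z‖ ≠ 0 := norm_ne_zero_iff.2 (hc z hz).1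
    simpa [hx, (hc z hz).1] using this

/-- The Gauss map of a minimal surface is a harmonic map. -/
theorem laplace_unitNormal (hW : IsOpen W) (hf : ContDiffOn ℝ ∞ f W)
    (hc : ∀ z ∈ W, IsConformalImmersionAt f z) (hm : ∀ z ∈ W, meanCurv f z = 0) (hz : z ∈ W) :
    dX (dX (unitNormal f)) z + dY (dY (unitNormal f)) z =
      -(‖dX (unitNormal f) z‖ ^ 2 + ‖dY (unitNormal f) z‖ ^ 2) • unitNormal f z ∧
    ⟪dX f z, dX (unitNormal f) z⟫ + ⟪dY f z, dY (unitNormal f) z⟫ = 0 := by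
  have hN := contDiffOn_unitNormal hW hf hc
  have hfx := contDiffOn_dX hW hf
  have hfy := contDiffOn_dY hW hf
  have hfxx := contDiffOn_dX hW hfx
  have hfyy := contDiffOn_dY hW hfy
  have hΔ := laplace_eq_zero hW hf hc hm hz
  obtain ⟨a1, a2, a3, a4⟩ := conformal_derivatives hW hf hc hz
  have hz0 := (contDiffOn_const (c := (0 : E3)) (s := W) (𝕜 := ℝ) (n := ∞))
  have hNN : ∀ z ∈ W, ⟪unitNormal f z, unitNormal f z⟫ = 1 :=
    fun z hz => (hc z hz).inner_unitNormal_self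
  -- A fixed unit vector, so that the constant `1` is an inner product and `dX_inner_congr` applies
  -- to `|N|² = 1`.
  obtain ⟨e, he⟩ : ∃ e : E3, ⟪e, e⟫ = 1 := ⟨_, hNN z hz⟩
  have hNN' : ∀ z ∈ W, ⟪unitNormal f z, unitNormal f z⟫ = ⟪e, e⟫ :=
    fun z hz => (hNN z hz).trans he.symm
  have hNx : ∀ z ∈ W, ⟪unitNormal f z, dX f z⟫ = ⟪(0 : E3), 0⟫ := fun z _ => by
    rw [inner_unitNormal_dX, inner_zero_left]
  have hNy : ∀ z ∈ W, ⟪unitNormal f z, dY f z⟫ = ⟪(0 : E3), 0⟫ := fun z _ => by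
    rw [inner_unitNormal_dY, inner_zero_left]
  have b1 := dX_inner_congr hW hN hN contDiffOn_const contDiffOn_const hNN' hz
  have b2 := dY_inner_congr hW hN hN contDiffOn_const contDiffOn_const hNN' hz
  have b3 := dX_inner_congr hW hN hfx hz0 hz0 hNx hz
  have b4 := dY_inner_congr hW hN hfx hz0 hz0 hNx hz
  have b5 := dX_inner_congr hW hN hfy hz0 hz0 hNy hz
  have b6 := dY_inner_congr hW hN hfy hz0 hz0 hNy hz
  have c1 := laplacian_inner hW hN hN hz
  have c2 := laplacian_inner hW hN hfx hz
  have c3 := laplacian_inner hW hN hfy hz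
  have hconst : ∀ {g : ℂ → ℝ} {c : ℝ}, (∀ z ∈ W, g z = c) → Laplacian.laplacian g z = 0 :=
    fun {g c} h => by
      rw [(InnerProductSpace.laplacian_congr_nhds (f₂ := fun _ => c)
        (Filter.eventuallyEq_of_mem (hW.mem_nhds hz) h)).eq_of_nhds]
      simp
  rw [hconst hNN] at c1
  rw [hconst hNx] at c2
  rw [hconst hNy] at c3
  -- Differentiating `Δf = 0` shows that `f_x` and `f_y` are harmonic too, which removes the last
  -- terms of `c2` and `c3`.
  have hsum : ∀ z ∈ W, dX (dX f) z + dY (dY f) z = 0 := fun z hz => laplace_eq_zero hW hf hc hm hz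
  have hd : fderiv ℝ (fun z => dX (dX f) z + dY (dY f) z) z = 0 := by
    rw [fderiv_congr_of_isOpen hW (g := fun _ => (0 : E3)) hsum hz]
    simp
  rw [fderiv_fun_add (differentiableAt_of_smooth hW hfxx hz)
    (differentiableAt_of_smooth hW hfyy hz)] at hd
  have d1 : dX (dX (dX f)) z + dY (dY (dX f)) z = 0 := by
    have : dY (dY (dX f)) z = dY (dX (dY f)) z := congrArg (· Complex.I)
      (fderiv_congr_of_isOpen hW (fun w hw => (dX_dY hW hf hw).symm) hz)
    rw [this, ← dX_dY hW hfy hz]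
    exact congrArg (· 1) hd
  have d2 : dX (dX (dY f)) z + dY (dY (dY f)) z = 0 := by
    have : dX (dX (dY f)) z = dX (dY (dX f)) z := congrArg (· 1)
      (fderiv_congr_of_isOpen hW (fun w hw => dX_dY hW hf hw) hz)
    rw [this, dX_dY hW hfx hz]
    exact congrArg (· Complex.I) hd
  rw [d1, inner_zero_right] at c2
  rw [d2, inner_zero_right, dX_dY hW hf hz] at c3
  rw [dX_dY hW hf hz] at b5
  simp only [inner_zero_left, inner_zero_right, add_zero] at b3 b4 b5 b6
  have hdc : dX (fun _ : ℂ => e) z = 0 ∧ dY (fun _ : ℂ => e) z = 0 := by simp [dX, dY]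
  simp only [hdc.1, hdc.2, inner_zero_left, inner_zero_right, add_zero] at b1 b2
  set N := unitNormal f with hNdef
  have hyy : ⟪N z, dY (dY f) z⟫ = -⟪N z, dX (dX f) z⟫ := by
    have : ⟪N z, dX (dX f) z + dY (dY f) z⟫ = 0 := by rw [hΔ, inner_zero_right]
    rw [inner_add_right] at this
    linarith
  have hlam : ⟪dY f z, dY f z⟫ = ⟪dX f z, dX f z⟫ := by
    rw [real_inner_self_eq_norm_sq, real_inner_self_eq_norm_sq, (hc z hz).2.1]
  have hxy : ⟪dX f z, dY f z⟫ = 0 := (hc z hz).2.2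
  have hyx : ⟪dY f z, dX f z⟫ = 0 := by rw [real_inner_comm, hxy]
  have hl0 : ⟪dX f z, dX f z⟫ ≠ 0 := inner_self_ne_zero.2 (hc z hz).1
  have hNx0 : ⟪dX f z, N z⟫ = 0 := by rw [real_inner_comm]; exact inner_unitNormal_dX
  have hNy0 : ⟪dY f z, N z⟫ = 0 := by rw [real_inner_comm]; exact inner_unitNormal_dY
  have hNNx : ⟪dX N z, N z⟫ = 0 := by rw [real_inner_comm] at b1; linarith
  have hNNy : ⟪dY N z, N z⟫ = 0 := by rw [real_inner_comm] at b2; linarith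
  set lam := ⟪dX f z, dX f z⟫
  set P := ⟪N z, dX (dX f) z⟫
  set M := ⟪N z, dY (dX f) z⟫
  -- The Weingarten equations, with second fundamental form `(P, M; M, -P)`, trace free by `hyy`.
  have w1 : lam • dX N z + P • dX f z + M • dY f z = 0 := by
    apply (hc z hz).eq_zero_of_inner <;>
      simp only [inner_add_left, real_inner_smul_left, hxy, hyx, hlam]
    · linear_combination lam * b3
    · linear_combination lam * b5
    · rw [← hNdef, hNx0, hNy0, hNNx]; ring
  have w2 : lam • dY N z + M • dX f z + (-P) • dY f z = 0 := by
    apply (hc z hz).eq_zero_of_inner <;>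
      simp only [inner_add_left, real_inner_smul_left, hxy, hyx, hlam]
    · linear_combination lam * b4
    · linear_combination lam * b6 - lam * hyy
    · rw [← hNdef, hNx0, hNy0, hNNy]; ring
  have key : ∀ v w : E3, lam * (⟪dX N z, v⟫ + ⟪dY N z, w⟫) =
      -(P * ⟪v, dX f z⟫ + M * ⟪v, dY f z⟫ + M * ⟪w, dX f z⟫ - P * ⟪w, dY f z⟫) := fun v w => by
    have h1 := congrArg (fun x : E3 => ⟪x, v⟫) w1
    have h2 := congrArg (fun x : E3 => ⟪x, w⟫) w2
    simp only [inner_add_left, real_inner_smul_left, inner_zero_left] at h1 h2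
    rw [real_inner_comm v (dX f z), real_inner_comm v (dY f z)] at h1
    rw [real_inner_comm w (dX f z), real_inner_comm w (dY f z)] at h2
    linear_combination h1 + h2
  have k1 : ⟪dX N z, dX (dX f) z⟫ + ⟪dY N z, dY (dX f) z⟫ = 0 := by
    refine (mul_eq_zero.1 ((key _ _).trans ?_)).resolve_left hl0
    linear_combination -P * a1 - M * a3
  have k2 : ⟪dX N z, dY (dX f) z⟫ + ⟪dY N z, dY (dY f) z⟫ = 0 := by
    refine (mul_eq_zero.1 ((key _ _).trans ?_)).resolve_left hl0
    linear_combination -P * a2 - M * a4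
  constructor
  · rw [← sub_eq_zero]
    apply (hc z hz).eq_zero_of_inner
    · rw [inner_sub_left, real_inner_smul_left, real_inner_comm (dX f z) (N z), hNx0]
      linarith
    · rw [inner_sub_left, real_inner_smul_left, real_inner_comm (dY f z) (N z), hNy0]
      linarith
    · rw [inner_sub_left, real_inner_smul_left, ← hNdef, hNN z hz]
      rw [real_inner_self_eq_norm_sq, real_inner_self_eq_norm_sq, real_inner_comm (_ + _)] at c1
      linarith
  · rw [real_inner_comm (dX N z), real_inner_comm (dY N z)]
    linarith

/-- Of the three terms of `Δ⟪f - q, N⟫`, the one with `Δf` and the mixed one vanish; the one with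
`ΔN` cancels the potential. -/
theorem jacobiOp_support_eq_zero (hW : IsOpen W) (hf : ContDiffOn ℝ ∞ f W)
    (hc : ∀ z ∈ W, IsConformalImmersionAt f z) (hm : ∀ z ∈ W, meanCurv f z = 0) (q : E3)
    (hz : z ∈ W) : jacobiOp f (fun z => ⟪f z - q, unitNormal f z⟫) z = 0 := by
  have hN := contDiffOn_unitNormal hW hf hc
  obtain ⟨h1, h2⟩ := laplace_unitNormal hW hf hc hm hz
  have hx : dX (fun z => f z - q) = dX f := by
    ext1 z; simp only [dX]; rw [fderiv_sub_const]
  have hy : dY (fun z => f z - q) = dY f := by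
    ext1 z; simp only [dY]; rw [fderiv_sub_const]
  rw [jacobiOp, laplacian_inner hW (hf.sub contDiffOn_const) hN hz, hx, hy,
    laplace_eq_zero hW hf hc hm hz, h1, h2, inner_smul_right, inner_zero_left]
  ring

end Jacobi

/-! ### Isolated singularities of harmonic and holomorphic functions -/

section ComplexAnalysis

open Complex Metric

/-- The complex derivative `∂x/∂x - i ∂x/∂y` of a real function. -/
noncomputable def cderiv (x : ℂ → ℝ) (z : ℂ) : ℂ := fderiv ℝ x z 1 - I * fderiv ℝ x z I

theorem fderiv_eq_re_cderiv_mul (x : ℂ → ℝ) (z v : ℂ) : fderiv ℝ x z v = (cderiv x z * v).re := by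
  have hv : v = v.re • (1 : ℂ) + v.im • I := by
    apply Complex.ext <;> simp
  conv_lhs => rw [hv, map_add, map_smul, map_smul]
  simp [cderiv]
  ring

theorem hasFDerivAt_re_of_hasDerivAt {g : ℂ → ℂ} {g' z : ℂ} (h : HasDerivAt g g' z) :
    HasFDerivAt (fun z => (g z).re) (reCLM.comp (g' • (1 : ℂ →L[ℝ] ℂ))) z :=
  reCLM.hasFDerivAt.comp z h.complexToReal_fderiv

theorem cderiv_eq_deriv {x : ℂ → ℝ} {g : ℂ → ℂ} {z : ℂ} (hg : DifferentiableAt ℂ g z)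
    (h : x =ᶠ[𝓝 z] fun w => (g w).re) : cderiv x z = deriv g z := by
  rw [cderiv, h.fderiv_eq, (hasFDerivAt_re_of_hasDerivAt hg.hasDerivAt).fderiv]
  apply Complex.ext <;> simp

/-- Gradient estimate for bounded harmonic functions. -/
theorem norm_cderiv_le {x : ℂ → ℝ} {z : ℂ} {ρ ε : ℝ} (hρ : 0 < ρ) (hε : 0 < ε)
    (hx : InnerProductSpace.HarmonicOnNhd x (ball z ρ)) (hb : ∀ w ∈ ball z ρ, |x w| ≤ ε) :
    ‖cderiv x z‖ ≤ 2 * Real.exp 2 * ε / ρ := by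
  obtain ⟨g, hg, hgx⟩ := hx.exists_analyticOnNhd_ball_re_eq
  have hz : z ∈ ball z ρ := mem_ball_self hρ
  have hd : cderiv x z = deriv g z :=
    cderiv_eq_deriv (hg z hz).differentiableAt
      (eventuallyEq_of_mem (isOpen_ball.mem_nhds hz) fun w hw => (hgx hw).symm)
  -- Exponentiating turns the bound on `Re g` into `|k| ≤ e` on the ball and `|k z| ≥ e⁻¹`; Cauchy's
  -- estimate for `k'` on radius `ρ / 2` then bounds `g' = ε k' / k`.
  set k : ℂ → ℂ := fun w => exp (ε⁻¹ * g w) with hk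
  have hkn : ∀ w, ‖k w‖ = Real.exp (ε⁻¹ * (g w).re) := fun w => by
    rw [hk, norm_exp]
    simp
  have hkd : HasDerivAt k (k z * (ε⁻¹ * deriv g z)) z :=
    ((hg z hz).differentiableAt.hasDerivAt.const_mul _).cexp
  have hsub : closedBall z (ρ / 2) ⊆ ball z ρ := closedBall_subset_ball (by linarith)
  have hdiff : DifferentiableOn ℂ k (closedBall z (ρ / 2)) := fun w hw =>
    (((hg w (hsub hw)).differentiableAt.const_mul _).cexp).differentiableWithinAt
  have hC := norm_deriv_le_of_forall_mem_sphere_norm_le (f := k) (c := z) (R := ρ / 2)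
    (C := Real.exp 1) (by linarith) (hdiff.diffContOnCl_ball le_rfl) (fun w hw => by
      rw [hkn, Real.exp_le_exp, show (g w).re = x w from hgx (hsub (sphere_subset_closedBall hw))]
      rw [inv_mul_le_iff₀ hε, mul_one]
      exact (le_abs_self _).trans (hb w (hsub (sphere_subset_closedBall hw))))
  have hlow : Real.exp (-1) ≤ ‖k z‖ := by
    rw [hkn, Real.exp_le_exp, show (g z).re = x z from hgx hz]
    have := neg_le_of_abs_le (hb z hz)
    rw [le_inv_mul_iff₀ hε]
    linarith
  rw [hkd.deriv, norm_mul, norm_mul] at hC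
  have hε' : ‖(((ε : ℝ)⁻¹ : ℂ))‖ = ε⁻¹ := by
    rw [← ofReal_inv, norm_real, Real.norm_of_nonneg (inv_pos.2 hε).le]
  simp only [ofReal_inv] at hC
  rw [hε'] at hC
  have h1 : Real.exp (-1) * (ε⁻¹ * ‖deriv g z‖) ≤ Real.exp 1 / (ρ / 2) :=
    (mul_le_mul_of_nonneg_right hlow (by positivity)).trans hC
  rw [hd]
  have h2 : Real.exp 2 = Real.exp 1 * Real.exp 1 := by rw [← Real.exp_add]; norm_num
  rw [Real.exp_neg] at h1
  rw [h2]
  have he := Real.exp_pos 1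
  have h3 := mul_le_mul_of_nonneg_left h1 (mul_pos he hε).le
  calc ‖deriv g z‖ = Real.exp 1 * ε * ((Real.exp 1)⁻¹ * (ε⁻¹ * ‖deriv g z‖)) := by field_simp
    _ ≤ _ := h3
    _ = _ := by field_simp

theorem isPreconnected_punctured_ball (c : ℂ) (r : ℝ) : IsPreconnected (ball c r \ {c}) := by
  have h : ball c r \ {c} =
      (fun p : ℝ × ℝ => c + p.1 * exp (p.2 * I)) '' (Ioo 0 r ×ˢ univ) := by
    ext z
    constructor
    · rintro ⟨hz, hzc⟩
      refine ⟨(‖z - c‖, (z - c).arg), ⟨⟨norm_pos_iff.2 (sub_ne_zero.2 hzc), ?_⟩, mem_univ _⟩, ?_⟩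
      · exact mem_ball_iff_norm.1 hz
      · simp [norm_mul_exp_arg_mul_I]
    · rintro ⟨⟨s, t⟩, ⟨⟨hs, hs'⟩, -⟩, rfl⟩
      refine ⟨?_, ?_⟩
      · simp [norm_exp_ofReal_mul_I, abs_of_pos hs, hs']
      · simp [hs.ne', exp_ne_zero]
  rw [h]
  exact (isPreconnected_Ioo.prod isPreconnected_univ).image _ (by fun_prop)

theorem pos_or_neg_of_isPreconnected {W : Set ℂ} (hW : IsPreconnected W) {g : ℂ → ℝ}
    (hg : ContinuousOn g W) (h0 : ∀ z ∈ W, g z ≠ 0) :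
    (∀ z ∈ W, 0 < g z) ∨ ∀ z ∈ W, g z < 0 := by
  by_contra! h
  obtain ⟨⟨a, ha, ha'⟩, b, hb, hb'⟩ := h
  obtain ⟨w, hw, hw'⟩ := hW.intermediate_value ha hb hg ⟨ha', hb'⟩
  exact h0 w hw hw'

/-- A harmonic function with limit `0` at an isolated singularity is the real part of a holomorphic
function. -/
theorem exists_re_eq_of_harmonic_tendsto {x : ℂ → ℝ} {c : ℂ} {r : ℝ} (hr : 0 < r)
    (hx : InnerProductSpace.HarmonicOnNhd x (ball c r \ {c})) (h0 : Tendsto x (𝓝[≠] c) (𝓝 0)) :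
    ∃ Φ : ℂ → ℂ, DifferentiableOn ℂ Φ (ball c r) ∧ (Φ c).re = 0 ∧
      ∀ z ∈ ball c r \ {c}, x z = (Φ z).re ∧ cderiv x z = deriv Φ z := by
  have hW : IsOpen (ball c r \ {c}) := isOpen_ball.sdiff isClosed_singleton
  have hball : ball c r ∈ 𝓝 c := ball_mem_nhds c hr
  have hφ : DifferentiableOn ℂ (cderiv x) (ball c r \ {c}) := fun z hz =>
    (HarmonicAt.differentiableAt_complex_partial (hx z hz)).differentiableWithinAt
  have hO : cderiv x =o[𝓝[≠] c] fun z => (z - c)⁻¹ := by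
    rw [Asymptotics.isLittleO_iff]
    intro η hη
    -- Chosen so that the gradient estimate on the ball about `z` of radius `‖z - c‖`, which misses
    -- `c`, gives exactly `η / ‖z - c‖`.
    set ε := η / (2 * Real.exp 2) with hε
    have hε0 : 0 < ε := by positivity
    have h1 : ∀ᶠ z in 𝓝[≠] c, |x z| < ε := by
      have := h0.abs
      rw [abs_zero] at this
      exact this.eventually_lt_const hε0
    obtain ⟨δ, hδ, hδ'⟩ := Metric.mem_nhdsWithin_iff.1 h1
    have hs : ball c (min r δ / 2) ∈ 𝓝 c := ball_mem_nhds c (by positivity)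
    filter_upwards [inter_mem (nhdsWithin_le_nhds hs) self_mem_nhdsWithin] with z hz
    have hzc : 0 < ‖z - c‖ := norm_pos_iff.2 (sub_ne_zero.2 hz.2)
    have hz1 : ‖z - c‖ < min r δ / 2 := mem_ball_iff_norm.1 hz.1
    have hin : ∀ w ∈ ball z ‖z - c‖, w ∈ ball c (min r δ) \ {c} := fun w hw => by
      have hw' : ‖w - z‖ < ‖z - c‖ := mem_ball_iff_norm.1 hw
      refine ⟨mem_ball_iff_norm.2 ?_, ?_⟩
      · have := norm_sub_le_norm_sub_add_norm_sub w z c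
        linarith
      · rintro rfl
        rw [norm_sub_rev] at hw'
        exact lt_irrefl _ hw'
    have := norm_cderiv_le hzc hε0
      (fun w hw => hx w ⟨ball_subset_ball (min_le_left _ _) (hin w hw).1, (hin w hw).2⟩)
      (fun w hw => le_of_lt (hδ' ⟨ball_subset_ball (min_le_right _ _) (hin w hw).1, (hin w hw).2⟩))
    rw [norm_inv]
    refine this.trans (le_of_eq ?_)
    rw [hε]
    field_simp
  -- The removable singularity theorem wants the value at `c` subtracted. That value is arbitrary,
  -- but a constant is negligible against `(z - c)⁻¹`.
  have hO' : (fun z => cderiv x z - cderiv x c) =o[𝓝[≠] c] fun z => (z - c)⁻¹ := by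
    refine hO.sub (Asymptotics.isLittleO_const_left.2 (Or.inr ?_))
    have h1 : Tendsto (fun z : ℂ => z - c) (𝓝[≠] c) (𝓝[≠] 0) := by
      refine tendsto_nhdsWithin_iff.2 ⟨?_, ?_⟩
      · have : Tendsto (fun z : ℂ => z - c) (𝓝 c) (𝓝 (c - c)) := by
          exact (continuous_id.sub continuous_const).tendsto c
        rw [sub_self] at this
        exact this.mono_left nhdsWithin_le_nhds
      · filter_upwards [self_mem_nhdsWithin] with z hz
        exact sub_ne_zero.2 hz
    exact (tendsto_norm_inv_nhdsNE_zero_atTop.comp h1)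
  have hext := differentiableOn_update_limUnder_of_isLittleO hball hφ hO'
  obtain ⟨Φ, hΦ⟩ := hext.isExactOn_ball
  have hΦ' : ∀ z ∈ ball c r \ {c}, HasDerivAt Φ (cderiv x z) z := fun z hz => by
    have := hΦ z hz.1
    rwa [Function.update_of_ne hz.2] at this
  have hxd : ∀ z ∈ ball c r \ {c}, DifferentiableAt ℝ x z := fun z hz =>
    (hx z hz).1.differentiableAt (by norm_num)
  -- The extended derivative has a primitive on the whole disc, so there is no logarithmic term and
  -- `x` differs from `Re Φ` by a constant.
  have hconst : ∀ z ∈ ball c r \ {c}, ∀ w ∈ ball c r \ {c},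
      x z - (Φ z).re = x w - (Φ w).re := fun z hz w hw => by
    refine hW.is_const_of_fderiv_eq_zero (𝕜 := ℝ) (f := fun z => x z - (Φ z).re)
      (isPreconnected_punctured_ball c r) (fun y hy => ?_) (fun y hy => ?_) hz hw
    · exact ((hxd y hy).sub
        (hasFDerivAt_re_of_hasDerivAt (hΦ' y hy)).differentiableAt).differentiableWithinAt
    · have h1 := (hxd y hy).hasFDerivAt.sub (hasFDerivAt_re_of_hasDerivAt (hΦ' y hy))
      have h2 : fderiv ℝ (fun z => x z - (Φ z).re) y = _ := h1.fderiv
      rw [h2]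
      ext v
      simp [fderiv_eq_re_cderiv_mul]
  have hΦc : ContinuousAt Φ c := (hΦ c (mem_ball_self hr)).continuousAt
  set z₀ : ℂ := c + (r / 2 : ℝ) with hz₀
  have hz₀W : z₀ ∈ ball c r \ {c} := by
    refine ⟨?_, ?_⟩
    · rw [mem_ball_iff_norm, hz₀, add_sub_cancel_left, norm_real, Real.norm_of_nonneg] <;> linarith
    · have : ((r / 2 : ℝ) : ℂ) ≠ 0 := ofReal_ne_zero.2 (by linarith)
      simpa [hz₀] using hr.ne'
  set k := x z₀ - (Φ z₀).re
  have hk : ∀ z ∈ ball c r \ {c}, x z = (Φ z + k).re := fun z hz => by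
    have := hconst z hz z₀ hz₀W
    simp only [add_re, ofReal_re]
    linarith
  have hWmem : ball c r \ {c} ∈ 𝓝[≠] c := sdiff_mem_nhdsWithin_compl hball _
  refine ⟨fun z => Φ z + k, fun z hz => ((hΦ z hz).add_const _).differentiableAt.differentiableWithinAt,
    ?_, fun z hz => ⟨hk z hz, ?_⟩⟩
  · have h1 : Tendsto (fun z => (Φ z + k).re) (𝓝[≠] c) (𝓝 (Φ c + k).re) := by
      have : ContinuousAt (fun z => (Φ z + k).re) c :=
        continuous_re.continuousAt.comp (hΦc.add continuousAt_const)
      exact this.tendsto.mono_left nhdsWithin_le_nhds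
    refine tendsto_nhds_unique h1 (h0.congr' ?_)
    filter_upwards [hWmem] with z hz using hk z hz
  · exact (((hΦ' z hz).add_const _).deriv).symm

/-- At a pole, a function is a holomorphic multiple, with a zero, of its derivative. -/
theorem exists_eq_mul_deriv_of_tendsto_norm_atTop {H : ℂ → ℂ} {c : ℂ}
    (hH : ∀ᶠ z in 𝓝[≠] c, DifferentiableAt ℂ H z) (hinf : Tendsto (fun z => ‖H z‖) (𝓝[≠] c) atTop) :
    ∃ Q : ℂ → ℂ, AnalyticAt ℂ Q c ∧ Q c = 0 ∧ ∀ᶠ z in 𝓝[≠] c, H z = Q z * deriv H z := by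
  -- The reciprocal is analytic with a zero of finite order at `c`, and `H / H' = -K / K'`.
  set K : ℂ → ℂ := Function.update (fun z => (H z)⁻¹) c 0 with hKdef
  have hK0 : K c = 0 := Function.update_self _ _ _
  have hKne : ∀ z, z ≠ c → K z = (H z)⁻¹ := fun z hz => Function.update_of_ne hz _ _
  have hne : ∀ᶠ z in 𝓝[≠] c, H z ≠ 0 := by
    filter_upwards [hinf.eventually_gt_atTop 0] with z hz
    exact norm_pos_iff.1 hz
  have hH2 : ∀ᶠ z in 𝓝[≠] c, ∀ᶠ w in 𝓝 z, w ≠ c ∧ H w ≠ 0 ∧ DifferentiableAt ℂ H w := by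
    have h : ∀ᶠ w in 𝓝[≠] c, w ≠ c ∧ H w ≠ 0 ∧ DifferentiableAt ℂ H w :=
      eventually_mem_nhdsWithin.and (hne.and hH)
    filter_upwards [eventually_eventually_nhdsWithin.2 h, self_mem_nhdsWithin] with z hz hzc
    rwa [isOpen_compl_singleton.nhdsWithin_eq hzc] at hz
  have hKd : ∀ᶠ z in 𝓝[≠] c, HasDerivAt K (-deriv H z / H z ^ 2) z := by
    filter_upwards [hH2] with z hz
    have h1 := hz.self_of_nhds
    refine (h1.2.2.hasDerivAt.fun_inv h1.2.1).congr_of_eventuallyEq ?_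
    filter_upwards [hz] with w hw using hKne w hw.1
  have hKa : AnalyticAt ℂ K c := by
    refine analyticAt_of_differentiable_on_punctured_nhds_of_continuousAt ?_ ?_
    · filter_upwards [hKd] with z hz using hz.differentiableAt
    · refine continuousAt_update_same.2 ?_
      exact (tendsto_inv₀_cobounded.comp (tendsto_norm_atTop_iff_cobounded.1 hinf))
  have hKnz : ¬ ∀ᶠ z in 𝓝 c, K z = 0 := fun h => by
    have h1 : ∀ᶠ z in 𝓝[≠] c, False := by
      filter_upwards [hne, h.filter_mono nhdsWithin_le_nhds, self_mem_nhdsWithin] with z h1 h2 h3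
      rw [hKne z h3] at h2
      exact h1 (inv_eq_zero.1 h2)
    exact (inferInstance : (𝓝[≠] c).NeBot).ne (eventually_false_iff_eq_bot.1 h1)
  obtain ⟨n, k, hk, hkc, hKk⟩ := hKa.exists_eventuallyEq_pow_smul_nonzero_iff.2 hKnz
  have hn : n ≠ 0 := by
    rintro rfl
    have := hKk.self_of_nhds
    simp [hK0] at this
    exact hkc this.symm
  obtain ⟨m, rfl⟩ := Nat.exists_eq_succ_of_ne_zero hn
  -- From `K = (z - c)^(m+1) k` one gets `K' = (z - c)^m D`, so `K / K' = (z - c) k / D` vanishes at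
  -- `c`.
  set D : ℂ → ℂ := fun z => (m + 1) * k z + (z - c) * deriv k z with hD
  have hDa : AnalyticAt ℂ D c :=
    (analyticAt_const.mul hk).add ((analyticAt_id.sub analyticAt_const).mul hk.deriv)
  have hDc : D c ≠ 0 := by
    simp only [hD, sub_self, zero_mul, add_zero]
    exact mul_ne_zero (by exact_mod_cast m.succ_ne_zero) hkc
  refine ⟨fun z => -((z - c) * k z / D z),
    (((analyticAt_id.sub analyticAt_const).mul hk).div hDa hDc).neg, by simp, ?_⟩
  have hkd : ∀ᶠ z in 𝓝 c, DifferentiableAt ℂ k z :=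
    hk.eventually_analyticAt.mono fun z hz => hz.differentiableAt
  filter_upwards [hKd, hne, self_mem_nhdsWithin,
    (hKk.eventually_nhds.and (hkd.and (hDa.continuousAt.eventually_ne hDc))).filter_mono
      nhdsWithin_le_nhds] with z h1 h2 h3 ⟨h4, h5, h6⟩
  have hzc : z - c ≠ 0 := sub_ne_zero.2 h3
  have h7 : HasDerivAt K ((z - c) ^ m * D z) z := by
    have h8 := (((hasDerivAt_id z).sub_const c).pow (m + 1)).mul h5.hasDerivAt
    refine (h8.congr_of_eventuallyEq h4).congr_deriv ?_
    simp [hD]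
    ring
  have h9 := h1.unique h7
  have h10 : (H z)⁻¹ = (z - c) ^ (m + 1) * k z := by
    rw [← hKne z h3, h4.self_of_nhds]
    rfl
  have h11 : deriv H z = -((z - c) ^ m * D z) * H z ^ 2 := by
    rw [← h9]
    field_simp
  have h12 : H z * ((z - c) ^ (m + 1) * k z) = 1 := by rw [← h10, mul_inv_cancel₀ h2]
  rw [h11]
  field_simp
  linear_combination -h12

end ComplexAnalysis

/-! ### Smooth extension of the support expression through the puncture -/

section Extension

open Complex Metric

/-- The differential of `x₁ + i x₂` is `v ↦ (a v + conj (b v)) / 2`; subtracting `conj B` with `B' =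
b / 2` cancels its antiholomorphic part. -/
theorem hasDerivAt_sub_conj {x₁ x₂ : ℂ → ℝ} {B : ℂ → ℂ} {z : ℂ} (h₁ : DifferentiableAt ℝ x₁ z)
    (h₂ : DifferentiableAt ℝ x₂ z)
    (hB : HasDerivAt B ((cderiv x₁ z - I * cderiv x₂ z) / 2) z) :
    HasDerivAt (fun z => (x₁ z : ℂ) + I * x₂ z - (starRingEnd ℂ) (B z))
      ((cderiv x₁ z + I * cderiv x₂ z) / 2) z := by
  have h1 : HasFDerivAt (fun z => (x₁ z : ℂ)) (ofRealCLM.comp (fderiv ℝ x₁ z)) z :=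
    ofRealCLM.hasFDerivAt.comp z h₁.hasFDerivAt
  have h2 : HasFDerivAt (fun z => (x₂ z : ℂ)) (ofRealCLM.comp (fderiv ℝ x₂ z)) z :=
    ofRealCLM.hasFDerivAt.comp z h₂.hasFDerivAt
  have h3 : HasFDerivAt (fun z => (starRingEnd ℂ) (B z))
      (conjCLE.toContinuousLinearMap.comp
        (((cderiv x₁ z - I * cderiv x₂ z) / 2) • (1 : ℂ →L[ℝ] ℂ))) z :=
    conjCLE.toContinuousLinearMap.hasFDerivAt.comp z hB.complexToReal_fderiv
  have h4 := (h1.add (h2.const_mul I)).sub h3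
  rw [hasDerivAt_iff_hasFDerivAt]
  refine hasFDerivAt_of_restrictScalars ℝ h4 ?_
  refine ContinuousLinearMap.ext fun v => ?_
  apply Complex.ext <;> simp [fderiv_eq_re_cderiv_mul, -map_div₀, -map_sub, -map_mul] <;> ring

/-- The support function of a planar end, in terms of the coordinate functions `x₁`, `x₂`, `x₃`
with `x₃` tending to zero, extends smoothly by zero through the puncture. -/
theorem exists_contDiffAt_extension {x₁ x₂ x₃ : ℂ → ℝ} {c : ℂ} {r : ℝ} (hr : 0 < r)
    (h₁ : InnerProductSpace.HarmonicOnNhd x₁ (ball c r \ {c}))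
    (h₂ : InnerProductSpace.HarmonicOnNhd x₂ (ball c r \ {c}))
    (h₃ : InnerProductSpace.HarmonicOnNhd x₃ (ball c r \ {c}))
    (hconf : ∀ z ∈ ball c r \ {c}, cderiv x₁ z ^ 2 + cderiv x₂ z ^ 2 + cderiv x₃ z ^ 2 = 0)
    (hdet : ∀ z ∈ ball c r \ {c},
      ‖cderiv x₁ z - I * cderiv x₂ z‖ < ‖cderiv x₁ z + I * cderiv x₂ z‖)
    (h0 : Tendsto x₃ (𝓝[≠] c) (𝓝 0))
    (hinf : Tendsto (fun z => ‖(x₁ z : ℂ) + I * x₂ z‖) (𝓝[≠] c) atTop) :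
    ∃ U : ℂ → ℝ, ContDiffAt ℝ ∞ U c ∧ U c = 0 ∧ ∀ᶠ z in 𝓝[≠] c,
      U z * (1 + normSq (cderiv x₃ z / (cderiv x₁ z + I * cderiv x₂ z))) =
        -2 * (((x₁ z : ℂ) + I * x₂ z) * (cderiv x₃ z / (cderiv x₁ z + I * cderiv x₂ z))).re
          + x₃ z * (1 - normSq (cderiv x₃ z / (cderiv x₁ z + I * cderiv x₂ z))) := by
  have hball : ball c r ∈ 𝓝 c := ball_mem_nhds c hr
  have hWmem : ball c r \ {c} ∈ 𝓝[≠] c := sdiff_mem_nhdsWithin_compl hball _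
  obtain ⟨Φ, hΦ, hΦc, hΦx⟩ := exists_re_eq_of_harmonic_tendsto hr h₃ h0
  set a : ℂ → ℂ := fun z => cderiv x₁ z + I * cderiv x₂ z with ha
  set b : ℂ → ℂ := fun z => cderiv x₁ z - I * cderiv x₂ z with hb
  set G : ℂ → ℂ := fun z => cderiv x₃ z / a z with hG
  have ha0 : ∀ z ∈ ball c r \ {c}, a z ≠ 0 := fun z hz =>
    norm_pos_iff.1 ((norm_nonneg _).trans_lt (hdet z hz))
  have hab : ∀ z ∈ ball c r \ {c}, a z * b z = -cderiv x₃ z ^ 2 := fun z hz => by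
    linear_combination hconf z hz - cderiv x₂ z ^ 2 * I_sq
  have hGb : ∀ z ∈ ball c r \ {c}, b z = -(cderiv x₃ z * G z) := fun z hz => by
    have := ha0 z hz
    simp only [hG]
    field_simp
    linear_combination hab z hz
  have hcd : ∀ {x : ℂ → ℝ}, InnerProductSpace.HarmonicOnNhd x (ball c r \ {c}) →
      DifferentiableOn ℂ (cderiv x) (ball c r \ {c}) := fun hx z hz =>
    (HarmonicAt.differentiableAt_complex_partial (hx z hz)).differentiableWithinAt
  have hGd : DifferentiableOn ℂ G (ball c r \ {c}) :=
    (hcd h₃).div ((hcd h₁).add ((hcd h₂).const_mul I)) ha0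
  have hGbd : ∀ z ∈ ball c r \ {c}, ‖G z‖ ≤ 1 := fun z hz => by
    have h1 : ‖cderiv x₃ z‖ ^ 2 = ‖a z‖ * ‖b z‖ := by
      rw [← norm_pow, ← norm_mul, hab z hz, norm_neg]
    have h2 : ‖b z‖ < ‖a z‖ := hdet z hz
    have h3 : 0 < ‖a z‖ := norm_pos_iff.2 (ha0 z hz)
    simp only [hG]
    rw [norm_div, div_le_one h3]
    refine le_of_sq_le_sq ?_ h3.le
    rw [h1]
    nlinarith
  set G' := Function.update G c (limUnder (𝓝[≠] c) G) with hG'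
  have hG'd : DifferentiableOn ℂ G' (ball c r) :=
    differentiableOn_update_limUnder_of_bddAbove hball hGd
      ⟨1, by rintro _ ⟨z, hz, rfl⟩; exact hGbd z hz⟩
  have hG'e : ∀ z ∈ ball c r \ {c}, G' z = G z := fun z hz => Function.update_of_ne hz.2 _ _
  have hΦ'd : DifferentiableOn ℂ (deriv Φ) (ball c r) := hΦ.deriv isOpen_ball
  -- `-Φ' G' / 2` is the holomorphic extension of `b / 2`. The normalisation `B c = 0` is what makes
  -- the extension vanish at `c`.
  obtain ⟨B, hB⟩ := ((hΦ'd.mul hG'd).div_const (-2)).isExactOn_ball.with_val_at c 0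
  obtain ⟨hBc, hB⟩ := hB
  have hxd : ∀ {x : ℂ → ℝ}, InnerProductSpace.HarmonicOnNhd x (ball c r \ {c}) →
      ∀ z ∈ ball c r \ {c}, DifferentiableAt ℝ x z := fun hx z hz =>
    (hx z hz).1.differentiableAt (by norm_num)
  set H : ℂ → ℂ := fun z => (x₁ z : ℂ) + I * x₂ z - (starRingEnd ℂ) (B z) with hH
  have hHd : ∀ z ∈ ball c r \ {c}, HasDerivAt H (a z / 2) z := fun z hz => by
    refine hasDerivAt_sub_conj (hxd h₁ z hz) (hxd h₂ z hz) ((hB z hz.1).congr_deriv ?_)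
    have := hGb z hz
    simp only [hb] at this
    rw [this, Pi.mul_apply, hG'e z hz, (hΦx z hz).2]
    ring
  have hHinf : Tendsto (fun z => ‖H z‖) (𝓝[≠] c) atTop := by
    have hB1 : ∀ᶠ z in 𝓝[≠] c, ‖B z‖ < 1 := by
      have h1 : Tendsto (fun z => ‖B z‖) (𝓝[≠] c) (𝓝 ‖B c‖) :=
        ((hB c (mem_ball_self hr)).continuousAt.norm.tendsto).mono_left nhdsWithin_le_nhds
      rw [hBc, norm_zero] at h1
      exact h1.eventually_lt_const one_pos
    refine tendsto_atTop_mono' _ ?_ (tendsto_atTop_add_const_right _ (-1) hinf)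
    filter_upwards [hB1] with z hz
    have := norm_sub_norm_le ((x₁ z : ℂ) + I * x₂ z) ((starRingEnd ℂ) (B z))
    rw [norm_conj] at this
    linarith
  obtain ⟨Q, hQ, hQc, hQH⟩ := exists_eq_mul_deriv_of_tendsto_norm_atTop
    (by filter_upwards [hWmem] with z hz using (hHd z hz).differentiableAt) hHinf
  have hsm : ∀ {g : ℂ → ℂ}, AnalyticAt ℂ g c → ContDiffAt ℝ ∞ g c := fun hg =>
    hg.contDiffAt.restrict_scalars ℝ
  have hsd : ∀ {g : ℂ → ℂ}, DifferentiableOn ℂ g (ball c r) → ContDiffAt ℝ ∞ g c := fun hg =>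
    hsm (hg.analyticAt hball)
  have hre : ∀ {g : ℂ → ℂ}, ContDiffAt ℝ ∞ g c → ContDiffAt ℝ ∞ (fun z => (g z).re) c :=
    fun hg => reCLM.contDiff.contDiffAt.comp c hg
  have him : ∀ {g : ℂ → ℂ}, ContDiffAt ℝ ∞ g c → ContDiffAt ℝ ∞ (fun z => (g z).im) c :=
    fun hg => imCLM.contDiff.contDiffAt.comp c hg
  have hBs : ContDiffAt ℝ ∞ (fun z => (starRingEnd ℂ) (B z)) c :=
    conjCLE.contDiff.contDiffAt.comp c
      (hsd fun z hz => (hB z hz).differentiableAt.differentiableWithinAt)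
  have hns : ContDiffAt ℝ ∞ (fun z => normSq (G' z)) c := by
    simp only [normSq_apply]
    exact ((hre (hsd hG'd)).mul (hre (hsd hG'd))).add ((him (hsd hG'd)).mul (him (hsd hG'd)))
  have hpos : ∀ w : ℂ, 1 + normSq w ≠ 0 := fun w => by
    have := normSq_nonneg w
    positivity
  refine ⟨fun z => (-2 * (deriv Φ z * Q z * (1 / 2) + (starRingEnd ℂ) (B z) * G' z).re
    + (Φ z).re * (1 - normSq (G' z))) / (1 + normSq (G' z)), ?_, ?_, ?_⟩
  · refine ContDiffAt.div ?_ (contDiffAt_const.add hns) (hpos _)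
    refine (contDiffAt_const.mul (hre ?_)).add
      ((hre (hsd hΦ)).mul (contDiffAt_const.sub hns))
    exact (((hsd hΦ'd).mul (hsm hQ)).mul contDiffAt_const).add (hBs.mul (hsd hG'd))
  · simp [hQc, hBc, hΦc]
  · filter_upwards [hWmem, hQH] with z hz hq
    rw [(hHd z hz).deriv] at hq
    -- The pole of `F` cancels: `H G = Q (a / 2) G = Q Φ' / 2`, and the right side is smooth at `c`.
    have hFG : ((x₁ z : ℂ) + I * x₂ z) * G z =
        deriv Φ z * Q z * (1 / 2) + (starRingEnd ℂ) (B z) * G' z := by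
      have h1 : (x₁ z : ℂ) + I * x₂ z = H z + (starRingEnd ℂ) (B z) := by
        simp only [hH, sub_add_cancel]
      have h2 : a z * G z = cderiv x₃ z := mul_div_cancel₀ _ (ha0 z hz)
      rw [h1, hq, hG'e z hz, ← (hΦx z hz).2, ← h2]
      ring
    change _ * (1 + normSq (G z)) = -2 * (((x₁ z : ℂ) + I * x₂ z) * G z).re
      + x₃ z * (1 - normSq (G z))
    rw [hFG, (hΦx z hz).1, ← hG'e z hz]
    exact div_mul_cancel₀ _ (hpos _)

end Extension

/-! ### The support function of a graphical end -/

section End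

open Complex Metric

/-- The normal of a minimal surface in terms of the stereographic projection `G` of its
Gauss map. -/
theorem normal_eq_of_stereographic {a b φ G : ℂ} {ν₁ ν₂ ν₃ : ℝ} (ha : a ≠ 0) (hφ : φ = a * G)
    (hb : b = -(a * G ^ 2)) (hG : normSq G < 1) (hn : ν₁ ^ 2 + ν₂ ^ 2 + ν₃ ^ 2 = 1)
    (ht : ((ν₁ : ℂ) - I * ν₂) * a + (ν₁ + I * ν₂) * b + 2 * ν₃ * φ = 0) :
    (ν₃ * (1 + normSq G) / (1 - normSq G)) ^ 2 = 1 ∧ ∀ x₁ x₂ x₃ : ℝ,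
      (ν₁ * x₁ + ν₂ * x₂ + ν₃ * x₃) * (1 + normSq G) = ν₃ * (1 + normSq G) / (1 - normSq G) *
        (-2 * (((x₁ : ℂ) + I * x₂) * G).re + x₃ * (1 - normSq G)) := by
  have h1 : a * ((ν₁ - I * ν₂) - (ν₁ + I * ν₂) * G ^ 2 + 2 * ν₃ * G) = 0 := by
    rw [hφ, hb] at ht
    linear_combination ht
  have h2 := (mul_eq_zero.1 h1).resolve_left ha
  have hre := congrArg Complex.re h2
  have him := congrArg Complex.im h2
  simp [pow_two] at hre him
  have hg0 := normSq_nonneg G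
  set g := normSq G with hg
  have hg' : g = G.re * G.re + G.im * G.im := normSq_apply G
  have h3 : ν₁ * (1 - g) = -2 * ν₃ * G.re := by
    -- Cramer's rule for `hre`, `him` as a linear system in `ν₁, ν₂`; up to sign its determinant is
    -- `1 - g² = (1 + g) (1 - g)`.
    have : (1 + g) * (ν₁ * (1 - g)) = (1 + g) * (-2 * ν₃ * G.re) := by
      rw [hg']
      linear_combination (1 + G.re * G.re - G.im * G.im) * hre + 2 * G.re * G.im * him
    exact mul_left_cancel₀ (by positivity) this
  have h4 : ν₂ * (1 - g) = 2 * ν₃ * G.im := by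
    have : (1 + g) * (ν₂ * (1 - g)) = (1 + g) * (2 * ν₃ * G.im) := by
      rw [hg']
      linear_combination -2 * G.re * G.im * hre - (1 - G.re * G.re + G.im * G.im) * him
    exact mul_left_cancel₀ (by positivity) this
  have h5 : 1 - g ≠ 0 := by linarith
  constructor
  · rw [div_pow, div_eq_one_iff_eq (pow_ne_zero 2 h5)]
    have h6 : (ν₁ * (1 - g)) ^ 2 + (ν₂ * (1 - g)) ^ 2 + (ν₃ * (1 - g)) ^ 2 = (1 - g) ^ 2 := by
      linear_combination (1 - g) ^ 2 * hn
    rw [h3, h4] at h6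
    linear_combination h6 + 4 * ν₃ ^ 2 * hg'
  · intro x₁ x₂ x₃
    have h7 : (((x₁ : ℂ) + I * x₂) * G).re = x₁ * G.re - x₂ * G.im := by simp
    rw [h7]
    field_simp
    linear_combination x₁ * h3 + x₂ * h4

variable {f : ℂ → E3} {W : Set ℂ} {z : ℂ} {e e₁ e₂ e₃ q : E3}

theorem fderiv_inner_sub (hW : IsOpen W) (hf : ContDiffOn ℝ ∞ f W) (hz : z ∈ W) (v : ℂ) :
    fderiv ℝ (fun z => ⟪e, f z - q⟫) z v = ⟪e, fderiv ℝ f z v⟫ := by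
  rw [fderiv_inner_apply ℝ (differentiableAt_const e)
    ((differentiableAt_of_smooth hW hf hz).sub_const q), fderiv_sub_const]
  simp

theorem cderiv_inner_sub (hW : IsOpen W) (hf : ContDiffOn ℝ ∞ f W) (hz : z ∈ W) :
    cderiv (fun z => ⟪e, f z - q⟫) z = ⟪e, dX f z⟫ - I * ⟪e, dY f z⟫ := by
  rw [cderiv, fderiv_inner_sub hW hf hz, fderiv_inner_sub hW hf hz]
  rfl

theorem harmonicOnNhd_inner_sub (hW : IsOpen W) (hf : ContDiffOn ℝ ∞ f W)
    (hc : ∀ z ∈ W, IsConformalImmersionAt f z) (hm : ∀ z ∈ W, meanCurv f z = 0) :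
    InnerProductSpace.HarmonicOnNhd (fun z => ⟪e, f z - q⟫) W := by
  intro z hz
  have h : InnerProductSpace.HarmonicAt f z := by
    refine ⟨(hf.contDiffAt (hW.mem_nhds hz)).of_le
      (WithTop.coe_le_coe.2 le_top : ((2 : ℕ∞) : ℕ∞ω) ≤ ((⊤ : ℕ∞) : ℕ∞ω)), ?_⟩
    filter_upwards [hW.mem_nhds hz] with w hw
    rw [laplacian_eq hW hf hw, laplace_eq_zero hW hf hc hm hw]
    rfl
  exact (h.sub (InnerProductSpace.harmonicAt_const q)).comp_CLM (innerSL ℝ e)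

/-- The projection of a graph to the plane is an immersion. -/
theorem det_ne_zero_of_graph (hW : IsOpen W) (hf : ContDiffOn ℝ ∞ f W)
    (hc : ∀ z ∈ W, IsConformalImmersionAt f z)
    (hE : ∀ v w : E3, ⟪v, w⟫ = ⟪e₁, v⟫ * ⟪e₁, w⟫ + ⟪e₂, v⟫ * ⟪e₂, w⟫ + ⟪e₃, v⟫ * ⟪e₃, w⟫)
    {h : ℂ → ℝ} (hh : ContDiff ℝ ∞ h)
    (hg : ∀ z ∈ W, ⟪e₃, f z - q⟫ = h ((⟪e₁, f z - q⟫ : ℝ) + I * (⟪e₂, f z - q⟫ : ℝ)))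
    (hz : z ∈ W) :
    ⟪e₁, dX f z⟫ * ⟪e₂, dY f z⟫ - ⟪e₁, dY f z⟫ * ⟪e₂, dX f z⟫ ≠ 0 := by
  have hd : ∀ e : E3, HasFDerivAt (fun z => ⟪e, f z - q⟫) ((innerSL ℝ e).comp (fderiv ℝ f z)) z :=
    fun e => (innerSL ℝ e).hasFDerivAt.comp z
      ((differentiableAt_of_smooth hW hf hz).hasFDerivAt.sub_const q)
  have hF := ((ofRealCLM.hasFDerivAt.comp z (hd e₁)).add
    ((ofRealCLM.hasFDerivAt.comp z (hd e₂)).const_mul I))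
  have hhF := (hh.differentiable (by simp) _).hasFDerivAt.comp z hF
  have heq := (hhF.congr_of_eventuallyEq
    (eventuallyEq_of_mem (hW.mem_nhds hz) fun w hw => hg w hw)).unique (hd e₃)
  -- By the chain rule for the graph equation, a vector killed by the projection is killed by the
  -- third component as well, hence by the injective differential of `f`.
  have hker : ∀ v, ⟪e₁, fderiv ℝ f z v⟫ = 0 → ⟪e₂, fderiv ℝ f z v⟫ = 0 → v = 0 := by
    intro v h1 h2
    have h3 : ⟪e₃, fderiv ℝ f z v⟫ = 0 := by
      have := congrArg (fun L : ℂ →L[ℝ] ℝ => L v) heq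
      simp [h1, h2] at this
      exact this.symm
    have h4 : fderiv ℝ f z v = 0 := by
      have := hE (fderiv ℝ f z v) (fderiv ℝ f z v)
      rw [h1, h2, h3] at this
      simpa using this
    have hv : v = v.re • (1 : ℂ) + v.im • I := by
      apply Complex.ext <;> simp
    rw [hv, map_add, map_smul, map_smul] at h4
    change v.re • dX f z + v.im • dY f z = 0 at h4
    obtain ⟨c1, c2, c3⟩ := hc z hz
    have c4 : dY f z ≠ 0 := by
      rw [← norm_ne_zero_iff, ← c2]
      exact norm_ne_zero_iff.2 c1
    have h5 := congrArg (fun y => ⟪dX f z, y⟫) h4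
    have h6 := congrArg (fun y => ⟪dY f z, y⟫) h4
    simp only [inner_add_right, real_inner_smul_right, inner_zero_right, c3,
      real_inner_comm (dX f z) (dY f z), mul_zero, add_zero, zero_add, mul_eq_zero,
      inner_self_eq_zero, c1, c4, or_false] at h5 h6
    exact Complex.ext h5 h6
  intro hD
  have hlin : ∀ (e : E3) (α β : ℝ), ⟪e, fderiv ℝ f z (α • (1 : ℂ) + β • I)⟫ =
      α * ⟪e, dX f z⟫ + β * ⟪e, dY f z⟫ := fun e α β => by
    rw [map_add, map_smul, map_smul, inner_add_right, real_inner_smul_right, real_inner_smul_right]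
    rfl
  -- If the determinant vanished, both vectors orthogonal to the rows of the projected differential
  -- would lie in its kernel; so both rows are zero and even `1` is in the kernel.
  have h1 := hker (⟪e₁, dY f z⟫ • (1 : ℂ) + (-⟪e₁, dX f z⟫) • I)
    (by rw [hlin]; ring) (by rw [hlin]; linear_combination -hD)
  have h2 := hker (⟪e₂, dY f z⟫ • (1 : ℂ) + (-⟪e₂, dX f z⟫) • I)
    (by rw [hlin]; linear_combination hD) (by rw [hlin]; ring)
  have h3 := hker 1 (by simpa [dX] using congrArg Complex.im h1)
    (by simpa [dX] using congrArg Complex.im h2)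
  exact one_ne_zero h3

/-- The support function of an embedded planar end extends smoothly by zero, when the end is
coherently oriented with its asymptotic plane. -/
theorem exists_support_extension_of_det_pos {c : ℂ} {r : ℝ} (hr : 0 < r)
    (hf : ContDiffOn ℝ ∞ f (ball c r \ {c}))
    (hc : ∀ z ∈ ball c r \ {c}, IsConformalImmersionAt f z)
    (hm : ∀ z ∈ ball c r \ {c}, meanCurv f z = 0)
    (hE : ∀ v w : E3, ⟪v, w⟫ = ⟪e₁, v⟫ * ⟪e₁, w⟫ + ⟪e₂, v⟫ * ⟪e₂, w⟫ + ⟪e₃, v⟫ * ⟪e₃, w⟫)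
    (h0 : Tendsto (fun z => ⟪e₃, f z - q⟫) (𝓝[≠] c) (𝓝 0))
    (hinf : Tendsto (fun z => ‖((⟪e₁, f z - q⟫ : ℝ) : ℂ) + I * (⟪e₂, f z - q⟫ : ℝ)‖)
      (𝓝[≠] c) atTop)
    (hdet : ∀ z ∈ ball c r \ {c},
      0 < ⟪e₁, dX f z⟫ * ⟪e₂, dY f z⟫ - ⟪e₁, dY f z⟫ * ⟪e₂, dX f z⟫) :
    ∃ U : ℂ → ℝ, ContDiffAt ℝ ∞ U c ∧ U c = 0 ∧
      ∀ᶠ z in 𝓝[≠] c, U z = ⟪f z - q, unitNormal f z⟫ := by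
  have hW : IsOpen (ball c r \ {c}) := isOpen_ball.sdiff isClosed_singleton
  have hWmem : ball c r \ {c} ∈ 𝓝[≠] c :=
    sdiff_mem_nhdsWithin_compl (ball_mem_nhds c hr) _
  have hh : ∀ e : E3, InnerProductSpace.HarmonicOnNhd (fun z => ⟪e, f z - q⟫) (ball c r \ {c}) :=
    fun e => harmonicOnNhd_inner_sub hW hf hc hm
  set x : E3 → ℂ → ℝ := fun e z => ⟪e, f z - q⟫ with hx
  have hcd : ∀ (e : E3), ∀ z ∈ ball c r \ {c},
      cderiv (x e) z = ⟪e, dX f z⟫ - I * ⟪e, dY f z⟫ := fun e z hz => cderiv_inner_sub hW hf hz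
  have hsq : ∀ z ∈ ball c r \ {c},
      cderiv (x e₁) z ^ 2 + cderiv (x e₂) z ^ 2 + cderiv (x e₃) z ^ 2 = 0 := fun z hz => by
    have h1 := hE (dX f z) (dX f z)
    have h2 := hE (dY f z) (dY f z)
    have h3 := hE (dX f z) (dY f z)
    rw [(hc z hz).2.2] at h3
    have h4 : ⟪dX f z, dX f z⟫ = ⟪dY f z, dY f z⟫ := by
      rw [real_inner_self_eq_norm_sq, real_inner_self_eq_norm_sq, (hc z hz).2.1]
    rw [h4, h2] at h1
    rw [hcd _ z hz, hcd _ z hz, hcd _ z hz]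
    apply Complex.ext
    · simp [pow_two]
      linear_combination -h1
    · simp [pow_two]
      linear_combination 2 * h3
  have hnorm : ∀ z ∈ ball c r \ {c},
      ‖cderiv (x e₁) z - I * cderiv (x e₂) z‖ < ‖cderiv (x e₁) z + I * cderiv (x e₂) z‖ :=
    fun z hz => by
      -- `|a|² - |b|²` is four times the determinant in `hdet`.
      refine lt_of_pow_lt_pow_left₀ 2 (norm_nonneg _) ?_
      rw [← normSq_eq_norm_sq, ← normSq_eq_norm_sq, hcd _ z hz, hcd _ z hz, normSq_apply,
        normSq_apply]
      simp
      linarith [hdet z hz]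
  obtain ⟨U, hU, hUc, hUe⟩ := exists_contDiffAt_extension hr (hh e₁) (hh e₂) (hh e₃) hsq hnorm h0
    hinf
  set a : ℂ → ℂ := fun z => cderiv (x e₁) z + I * cderiv (x e₂) z with ha
  have ha0 : ∀ z ∈ ball c r \ {c}, a z ≠ 0 := fun z hz =>
    norm_pos_iff.1 ((norm_nonneg _).trans_lt (hnorm z hz))
  set G : ℂ → ℂ := fun z => cderiv (x e₃) z / a z with hG
  have hφ : ∀ z ∈ ball c r \ {c}, cderiv (x e₃) z = a z * G z := fun z hz =>
    (mul_div_cancel₀ _ (ha0 z hz)).symm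
  have hb : ∀ z ∈ ball c r \ {c},
      cderiv (x e₁) z - I * cderiv (x e₂) z = -(a z * G z ^ 2) := fun z hz => by
    refine mul_left_cancel₀ (ha0 z hz) ?_
    have h1 := hsq z hz
    rw [hφ z hz] at h1
    linear_combination h1 - cderiv (x e₂) z ^ 2 * I_sq
  have hG1 : ∀ z ∈ ball c r \ {c}, normSq (G z) < 1 := fun z hz => by
    have h1 := hnorm z hz
    rw [hb z hz, norm_neg, norm_mul, norm_pow] at h1
    rw [normSq_eq_norm_sq]
    exact lt_of_mul_lt_mul_left (by simpa using h1) (norm_nonneg (a z))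
  set s : ℂ → ℝ := fun z =>
    ⟪e₃, unitNormal f z⟫ * (1 + normSq (G z)) / (1 - normSq (G z)) with hs
  have hkey := fun z hz => normal_eq_of_stereographic (ν₁ := ⟪e₁, unitNormal f z⟫)
    (ν₂ := ⟪e₂, unitNormal f z⟫) (ν₃ := ⟪e₃, unitNormal f z⟫) (ha0 z hz) (hφ z hz) (hb z hz)
    (hG1 z hz) (by
      have := hE (unitNormal f z) (unitNormal f z)
      rw [(hc z hz).inner_unitNormal_self] at this
      linear_combination -this) (by
      have h1 := hE (unitNormal f z) (dX f z)
      have h2 := hE (unitNormal f z) (dY f z)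
      rw [inner_unitNormal_dX] at h1
      rw [inner_unitNormal_dY] at h2
      simp only [ha]
      rw [hcd _ z hz, hcd _ z hz, hcd _ z hz]
      apply Complex.ext
      · simp
        linear_combination -2 * h1
      · simp
        linear_combination 2 * h2)
  have hcdc : ∀ e : E3, ContinuousOn (cderiv (x e)) (ball c r \ {c}) := fun e z hz =>
    (HarmonicAt.differentiableAt_complex_partial
      (hh e z hz)).continuousAt.continuousWithinAt
  have hGc : ContinuousOn (fun z => normSq (G z)) (ball c r \ {c}) :=
    continuous_normSq.comp_continuousOn
      ((hcdc e₃).div ((hcdc e₁).add (continuousOn_const.mul (hcdc e₂))) ha0)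
  have hsc : ContinuousOn s (ball c r \ {c}) :=
    ((continuousOn_const.inner (𝕜 := ℝ) (contDiffOn_unitNormal hW hf hc).continuousOn).mul
      (continuousOn_const.add hGc)).div (continuousOn_const.sub hGc)
      fun z hz => by linarith [hG1 z hz]
  have hs0 : ∀ z ∈ ball c r \ {c}, s z ≠ 0 := fun z hz h => by
    have h1 : s z ^ 2 = 1 := (hkey z hz).1
    rw [h] at h1
    norm_num at h1
  -- `s` is continuous with values `±1` on a connected set. It records which of the two unit normals
  -- is meant.
  obtain ⟨σ, hσ⟩ : ∃ σ : ℝ, ∀ z ∈ ball c r \ {c}, s z = σ := by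
    rcases pos_or_neg_of_isPreconnected (isPreconnected_punctured_ball c r) hsc hs0 with h | h
    · refine ⟨1, fun z hz => ?_⟩
      rcases (by simpa using (hkey z hz).1 : s z = 1 ∨ s z = -1) with h1 | h1
      · exact h1
      · exact absurd (h z hz) (by rw [h1]; norm_num)
    · refine ⟨-1, fun z hz => ?_⟩
      rcases (by simpa using (hkey z hz).1 : s z = 1 ∨ s z = -1) with h1 | h1
      · exact absurd (h z hz) (by rw [h1]; norm_num)
      · exact h1
  refine ⟨fun z => σ * U z, contDiffAt_const.mul hU, by simp [hUc], ?_⟩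
  filter_upwards [hWmem, hUe] with z hz hUz
  have h1 := (hkey z hz).2 (x e₁ z) (x e₂ z) (x e₃ z)
  change _ = s z * _ at h1
  have h2 : 1 + normSq (G z) ≠ 0 := by
    have := normSq_nonneg (G z)
    positivity
  refine mul_right_cancel₀ h2 ?_
  rw [hE]
  rw [hσ z hz] at h1
  change U z * (1 + normSq (G z)) = _ at hUz
  simp only [hx] at h1 hUz
  rw [← hUz] at h1
  linear_combination -h1

end End

/-! ### From the graph description of an end to the extension -/

section PlanarEnd

open Complex Metric

variable {f : ℂ → E3} {e₁ e₂ e₃ q : E3}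

/-- The graph equation supplies the missing hypotheses: the horizontal part tends to infinity, so
the height tends to `0`, and the projection determinant has constant sign. -/
theorem exists_support_extension_of_graph {c : ℂ} {r : ℝ} (hr : 0 < r)
    (hf : ContDiffOn ℝ ∞ f (ball c r \ {c}))
    (hc : ∀ z ∈ ball c r \ {c}, IsConformalImmersionAt f z)
    (hm : ∀ z ∈ ball c r \ {c}, meanCurv f z = 0)
    (hE : ∀ v w : E3, ⟪v, w⟫ = ⟪e₁, v⟫ * ⟪e₁, w⟫ + ⟪e₂, v⟫ * ⟪e₂, w⟫ + ⟪e₃, v⟫ * ⟪e₃, w⟫)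
    {h : ℂ → ℝ} (hh : ContDiff ℝ ∞ h) (hh0 : Tendsto h (cocompact ℂ) (𝓝 0))
    (hg : ∀ z ∈ ball c r \ {c},
      ⟪e₃, f z - q⟫ = h ((⟪e₁, f z - q⟫ : ℝ) + I * (⟪e₂, f z - q⟫ : ℝ)))
    (hinf : Tendsto f (𝓝[≠] c) (cocompact E3)) :
    ∃ U : ℂ → ℝ, ContDiffAt ℝ ∞ U c ∧ U c = 0 ∧
      ∀ᶠ z in 𝓝[≠] c, U z = ⟪f z - q, unitNormal f z⟫ := by
  have hW : IsOpen (ball c r \ {c}) := isOpen_ball.sdiff isClosed_singleton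
  have hWmem : ball c r \ {c} ∈ 𝓝[≠] c :=
    sdiff_mem_nhdsWithin_compl (ball_mem_nhds c hr) _
  set F : ℂ → ℂ := fun z => ((⟪e₁, f z - q⟫ : ℝ) : ℂ) + I * (⟪e₂, f z - q⟫ : ℝ) with hF
  have hnF : ∀ z, ‖F z‖ ^ 2 = ⟪e₁, f z - q⟫ ^ 2 + ⟪e₂, f z - q⟫ ^ 2 := fun z => by
    rw [← normSq_eq_norm_sq, normSq_apply, hF]
    simp
    ring
  have hfq : Tendsto (fun z => ‖f z - q‖ ^ 2) (𝓝[≠] c) atTop := by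
    have h1 : Tendsto (fun z => ‖f z‖ - ‖q‖) (𝓝[≠] c) atTop :=
      tendsto_atTop_add_const_right _ _ (tendsto_norm_cocompact_atTop.comp hinf)
    exact (tendsto_pow_atTop two_ne_zero).comp
      (tendsto_atTop_mono (fun z => norm_sub_norm_le (f z) q) h1)
  have hFinf : Tendsto (fun z => ‖F z‖) (𝓝[≠] c) atTop := by
    refine tendsto_atTop.2 fun M => ?_
    -- Where `‖F‖ ≤ M` the height `h (F z)` is bounded by `C`, so `‖f z - q‖² ≤ M² + C²`, which
    -- fails near `c`.
    obtain ⟨C, hC⟩ := (isCompact_closedBall (0 : ℂ) M).exists_bound_of_continuousOn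
      hh.continuous.continuousOn
    filter_upwards [hWmem, hfq.eventually_gt_atTop (M ^ 2 + C ^ 2)] with z hz hz'
    by_contra! hlt
    have h1 := hC (F z) (mem_closedBall_zero_iff.2 hlt.le)
    rw [← hg z hz, Real.norm_eq_abs] at h1
    have h2 : ⟪e₃, f z - q⟫ ^ 2 ≤ C ^ 2 := sq_le_sq' (abs_le.1 h1).1 (abs_le.1 h1).2
    have h3 : ‖F z‖ ^ 2 ≤ M ^ 2 := pow_le_pow_left₀ (norm_nonneg _) hlt.le 2
    have h4 := hE (f z - q) (f z - q)
    rw [real_inner_self_eq_norm_sq] at h4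
    have h5 := hnF z
    nlinarith
  have hFcc : Tendsto F (𝓝[≠] c) (cocompact ℂ) := by
    rw [← cobounded_eq_cocompact]
    exact tendsto_norm_atTop_iff_cobounded.1 hFinf
  have h0 : Tendsto (fun z => ⟪e₃, f z - q⟫) (𝓝[≠] c) (𝓝 0) := by
    refine (hh0.comp hFcc).congr' ?_
    filter_upwards [hWmem] with z hz using (hg z hz).symm
  have hx := (contDiffOn_dX hW hf).continuousOn
  have hy := (contDiffOn_dY hW hf).continuousOn
  have hdc : ContinuousOn (fun z => ⟪e₁, dX f z⟫ * ⟪e₂, dY f z⟫ - ⟪e₁, dY f z⟫ * ⟪e₂, dX f z⟫)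
      (ball c r \ {c}) :=
    ((continuousOn_const.inner (𝕜 := ℝ) hx).mul (continuousOn_const.inner (𝕜 := ℝ) hy)).sub
      ((continuousOn_const.inner (𝕜 := ℝ) hy).mul (continuousOn_const.inner (𝕜 := ℝ) hx))
  rcases pos_or_neg_of_isPreconnected (isPreconnected_punctured_ball c r) hdc
    (fun z hz => det_ne_zero_of_graph hW hf hc hE hh hg hz) with hdet | hdet
  · exact exists_support_extension_of_det_pos hr hf hc hm hE h0 hFinf hdet
  -- Reflecting `e₂` reverses the sign of the determinant and conjugates `F`, leaving `x₃` and the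
  -- support function unchanged.
  · refine exists_support_extension_of_det_pos (e₁ := e₁) (e₂ := -e₂) (e₃ := e₃) hr hf hc hm
      (fun v w => ?_) h0 (hFinf.congr fun z => ?_) (fun z hz => ?_)
    · rw [hE]
      simp only [inner_neg_left]
      ring
    · refine (pow_left_inj₀ (norm_nonneg _) (norm_nonneg _) two_ne_zero).1 ?_
      rw [hnF, ← normSq_eq_norm_sq, normSq_apply]
      simp
      ring
    · have := hdet z hz
      simp only [inner_neg_left]
      linarith

theorem inner_eq_of_orthonormal (ι : ℂ →ₗᵢ[ℝ] E3) {n : E3} (hn : ‖n‖ = 1) (hι : ∀ ζ, ⟪ι ζ, n⟫ = 0)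
    (v w : E3) :
    ⟪v, w⟫ = ⟪ι 1, v⟫ * ⟪ι 1, w⟫ + ⟪ι I, v⟫ * ⟪ι I, w⟫ + ⟪n, v⟫ * ⟪n, w⟫ := by
  have ho : Orthonormal ℝ ![ι 1, ι I, n] := by
    have hι' : ∀ ζ, ⟪n, ι ζ⟫ = 0 := fun ζ => by rw [real_inner_comm, hι]
    constructor
    · intro i
      fin_cases i <;> simp [hn]
    · intro i j hij
      fin_cases i <;> fin_cases j <;> simp [hι, hι'] at hij ⊢
  have h := ((basisOfOrthonormalOfCardEqFinrank ho (by simp)).toOrthonormalBasis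
    (by simpa using ho)).sum_inner_mul_inner v w
  rw [← h, Fin.sum_univ_three]
  simp [real_inner_comm]

end PlanarEnd

/-! ### Independence of the coordinate, and passage to the surface -/

section Assembly

variable {S : Type*} [TopologicalSpace S] [ChartedSpace ℂ S]

/-- A holomorphic coordinate change acts on `(f_x, f_y)` by multiplication by `α + iβ`, which scales
the cross product by `α² + β² > 0`. -/
theorem unitNormal_eq_of_fderiv {f f' : ℂ → E3} {z z' : ℂ} {α β : ℝ}
    (hx : dX f' z' = α • dX f z + β • dY f z) (hy : dY f' z' = -β • dX f z + α • dY f z)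
    (h : IsConformalImmersionAt f' z') : unitNormal f' z' = unitNormal f z := by
  have h0 := h.cross_ne_zero
  rw [unitNormal, unitNormal]
  rw [hx, hy, cross_linear_comb] at h0 ⊢
  have hpos : 0 < α ^ 2 + β ^ 2 :=
    lt_of_le_of_ne (by positivity) (smul_ne_zero_iff.1 h0).1.symm
  rw [norm_smul, Real.norm_of_nonneg hpos.le, smul_smul, mul_inv, mul_right_comm,
    inv_mul_cancel₀ hpos.ne', one_mul]

/-- The Gauss map can be computed in any holomorphic coordinate. -/
theorem gaussMap_eq [IsManifold 𝓘(ℂ) ω S] {X : S → E3} {P : Set S} (hP : IsClosed P)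
    (hs : IsSmoothOn X Pᶜ) (hc : ∀ e ∈ holCharts S, ∀ z ∈ e.target, e.symm z ∉ P →
      IsConformalImmersionAt (X ∘ e.symm) z) {e : OpenPartialHomeomorph S ℂ}
    (he : e ∈ holCharts S) {x : S} (hx : x ∈ e.source) (hxP : x ∉ P) :
    gaussMap X x = unitNormal (X ∘ e.symm) (e x) := by
  set e' := chartAt ℂ x with he'
  have he'm : e' ∈ holCharts S := IsManifold.chart_mem_maximalAtlas x
  have hx' : x ∈ e'.source := mem_chart_source ℂ x
  have hz' : e' x ∈ e'.target := e'.map_source hx'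
  have hsymm : e'.symm (e' x) = x := e'.left_inv hx'
  have hT : DifferentiableAt ℂ (e ∘ e'.symm) (e' x) := by
    have h1 : ContMDiffAt 𝓘(ℂ) 𝓘(ℂ) ω e (e'.symm (e' x)) := by
      rw [hsymm]
      exact contMDiffAt_of_mem_maximalAtlas he hx
    have h2 := h1.comp (e' x) (contMDiffAt_symm_of_mem_maximalAtlas he'm hz')
    exact (contMDiffAt_iff_contDiffAt.1 h2).differentiableAt (by simp)
  have hWo : IsOpen (e.target ∩ e.symm ⁻¹' Pᶜ) := e.isOpen_inter_preimage_symm hP.isOpen_compl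
  have hfd : DifferentiableAt ℝ (X ∘ e.symm) ((e ∘ e'.symm) (e' x)) := by
    rw [Function.comp_apply, hsymm]
    exact differentiableAt_of_smooth hWo (hs e he)
      ⟨e.map_source hx, by simpa [e.left_inv hx] using hxP⟩
  have hev : X ∘ e'.symm =ᶠ[𝓝 (e' x)] (X ∘ e.symm) ∘ (e ∘ e'.symm) := by
    have h1 : ∀ᶠ w in 𝓝 (e' x), e'.symm w ∈ e.source :=
      (e'.symm.continuousAt hz').eventually_mem (by rw [hsymm]; exact e.open_source.mem_nhds hx)
    filter_upwards [h1] with w hw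
    simp [e.left_inv hw]
  obtain ⟨T', hT'⟩ : ∃ T', HasDerivAt (e ∘ e'.symm) T' (e' x) := ⟨_, hT.hasDerivAt⟩
  have hcomp : ∀ v, fderiv ℝ (X ∘ e'.symm) (e' x) v = fderiv ℝ (X ∘ e.symm) (e x) (T' * v) := by
    intro v
    have h := (hfd.hasFDerivAt.comp (e' x) hT'.complexToReal_fderiv).congr_of_eventuallyEq hev
    rw [h.fderiv]
    simp [hsymm]
  have hlin : ∀ α β : ℝ, fderiv ℝ (X ∘ e.symm) (e x) (α • (1 : ℂ) + β • Complex.I) =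
      α • dX (X ∘ e.symm) (e x) + β • dY (X ∘ e.symm) (e x) := fun α β => by
    rw [map_add, map_smul, map_smul]
    rfl
  refine unitNormal_eq_of_fderiv (α := T'.re) (β := T'.im) ?_ ?_
    (hc e' he'm _ hz' (by rwa [hsymm]))
  · rw [dX, hcomp, ← hlin]
    congr 1
    apply Complex.ext <;> simp
  · rw [dY, hcomp, ← hlin]
    congr 1
    apply Complex.ext <;> simp

/-- The support function near an embedded planar end whose asymptotic plane contains `q`. -/
theorem exists_support_extension {X : S → E3} {P : Set S}
    (hX : IsCompleteMinimal X P) {p : S} {A : AffineSubspace ℝ E3}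
    (hA : IsEmbeddedPlanarEnd X P p A) {q : E3} (hq : q ∈ A) {e : OpenPartialHomeomorph S ℂ}
    (he : e ∈ holCharts S) {z : ℂ} (hz : z ∈ e.target) (hzp : e.symm z = p) :
    ∃ U : ℂ → ℝ, ContDiffAt ℝ ∞ U z ∧ U z = 0 ∧ ∀ᶠ w in 𝓝[≠] z, w ∈ e.target ∧ e.symm w ∉ P ∧
      U w = ⟪(X ∘ e.symm) w - q, unitNormal (X ∘ e.symm) w⟫ := by
  obtain ⟨hinf, o, n, ι, h, R, V, rfl, hn, hι, hh, hh0, -, hV, hpV, hdisj, -, himg⟩ := hA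
  obtain ⟨d, hd⟩ : ∃ d, q = o + ι d := by
    rw [AffineSubspace.mem_mk'] at hq
    obtain ⟨d, hd⟩ := hq
    refine ⟨d, ?_⟩
    have : ι d = q - o := hd
    rw [this]
    abel
  have hopen : IsOpen (e.target ∩ e.symm ⁻¹' V) := e.isOpen_inter_preimage_symm hV
  obtain ⟨r, hr, hball⟩ := Metric.isOpen_iff.1 hopen z ⟨hz, by rwa [mem_preimage, hzp]⟩
  have hne : ∀ w ∈ e.target, w ≠ z → e.symm w ≠ p := fun w hw hwz h =>
    hwz (e.symm.injOn hw hz (h.trans hzp.symm))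
  have hmem : ∀ w ∈ Metric.ball z r \ {z}, w ∈ e.target ∧ e.symm w ∈ V \ {p} ∧ e.symm w ∉ P :=
    fun w hw => by
      have h1 : e.symm w ∈ V \ {p} := ⟨(hball hw.1).2, hne w (hball hw.1).1 hw.2⟩
      exact ⟨(hball hw.1).1, h1, disjoint_left.1 hdisj h1⟩
  have hcoord : ∀ (ξ ζ : ℂ), ⟪ι ξ, o + ι ζ + h ζ • n - q⟫ = ⟪ξ, ζ - d⟫ := fun ξ ζ => by
    have : o + ι ζ + h ζ • n - q = ι (ζ - d) + h ζ • n := by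
      rw [hd, map_sub]
      abel
    rw [this, inner_add_right, real_inner_smul_right, hι, mul_zero, add_zero, ι.inner_map_map]
  -- Because `q = o + ι d` lies in the plane, the height relative to `q` is `h` with no constant
  -- added; only the horizontal coordinate is shifted by `d`.
  have hcoord3 : ∀ ζ : ℂ, ⟪n, o + ι ζ + h ζ • n - q⟫ = h ζ := fun ζ => by
    have : o + ι ζ + h ζ • n - q = ι (ζ - d) + h ζ • n := by
      rw [hd, map_sub]
      abel
    rw [this, inner_add_right, real_inner_smul_right, real_inner_comm, hι,
      real_inner_self_eq_norm_sq, hn]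
    norm_num
  have htend : Tendsto e.symm (𝓝[≠] z) (𝓝[≠] p) := by
    refine tendsto_nhdsWithin_iff.2 ⟨?_, ?_⟩
    · have := (e.symm.continuousAt hz).tendsto
      rw [hzp] at this
      exact this.mono_left nhdsWithin_le_nhds
    · filter_upwards [nhdsWithin_le_nhds (e.open_target.mem_nhds hz), self_mem_nhdsWithin]
        with w hw hwz using hne w hw hwz
  obtain ⟨U, hU, hUz, hUe⟩ := exists_support_extension_of_graph (f := X ∘ e.symm) (q := q) hr
    ((hX.smooth e he).mono fun w hw => ⟨(hmem w hw).1, (hmem w hw).2.2⟩)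
    (fun w hw => hX.conformal e he w (hmem w hw).1 (hmem w hw).2.2)
    (fun w hw => hX.minimal e he w (hmem w hw).1 (hmem w hw).2.2)
    (inner_eq_of_orthonormal ι hn hι) (h := fun ξ => h (ξ + d))
    (hh.comp (contDiff_id.add contDiff_const))
    (hh0.comp (Homeomorph.addRight d).isClosedEmbedding.tendsto_cocompact)
    (fun w hw => by
      obtain ⟨ζ, -, hζ⟩ : X (e.symm w) ∈ {y | ∃ ζ : ℂ, R < ‖ζ‖ ∧ y = o + ι ζ + h ζ • n} := by
        rw [← himg]
        exact mem_image_of_mem X (hmem w hw).2.1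
      rw [Function.comp_apply, hζ, hcoord3, hcoord, hcoord]
      congr 1
      apply Complex.ext <;> simp [Complex.inner])
    (hinf.comp htend)
  refine ⟨U, hU, hUz, ?_⟩
  filter_upwards [hUe, sdiff_mem_nhdsWithin_compl (Metric.ball_mem_nhds z hr) {z}] with w hw hw'
  exact ⟨(hmem w hw').1, (hmem w hw').2.2, hw⟩

theorem IsSmoothOn.continuous [IsManifold 𝓘(ℂ) ω S] {u : S → ℝ} (hu : IsSmoothOn u univ) :
    Continuous u := by
  refine continuous_iff_continuousAt.2 fun x => ?_
  set e := chartAt ℂ x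
  have hx : x ∈ e.source := mem_chart_source ℂ x
  have h1 : ContinuousAt (u ∘ e.symm) (e x) := by
    refine (hu e (IsManifold.chart_mem_maximalAtlas x)).continuousOn.continuousAt ?_
    simpa using e.open_target.mem_nhds (e.map_source hx)
  refine (h1.comp (e.continuousAt hx)).congr ?_
  filter_upwards [e.open_source.mem_nhds hx] with y hy
  simp [e.left_inv hy]

end Assembly

end PlanarEnds

theorem mainTheorem12 {S : Type*} [TopologicalSpace S] [ChartedSpace ℂ S] [IsManifold 𝓘(ℂ) ω S]
    (hS : Nonempty (S ≃ₜ Metric.sphere (0 : PlanarEnds.E3) 1))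
    {m : ℕ} (p : Fin m → S) (hp : Function.Injective p)
    (X : S → PlanarEnds.E3) (A : Fin m → AffineSubspace ℝ PlanarEnds.E3)
    (hX : PlanarEnds.IsCompleteMinimalWithPlanarEnds X p A)
    (q : PlanarEnds.E3) (hq : PlanarEnds.IsSpinyAt A q) :
    ∃ u : S → ℝ,
      (∀ x ∉ range p, u x = ⟪X x - q, PlanarEnds.gaussMap X x⟫) ∧
      PlanarEnds.IsBoundedJacobiField X (range p) u ∧
      PlanarEnds.IsSmoothOn u univ ∧
      ∀ i, u (p i) = 0 := by
  classical
  obtain ⟨φ⟩ := hS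
  have : T2Space S := φ.isEmbedding.t2Space
  have : CompactSpace (Metric.sphere (0 : PlanarEnds.E3) 1) :=
    isCompact_iff_compactSpace.1 (isCompact_sphere _ _)
  have : CompactSpace S := φ.symm.compactSpace
  have hP : IsClosed (range p) := (finite_range p).isClosed
  have hM := hX.isCompleteMinimal
  set u : S → ℝ := fun x => if x ∈ range p then 0 else ⟪X x - q, PlanarEnds.gaussMap X x⟫ with hu
  have hu1 : ∀ x ∉ range p, u x = ⟪X x - q, PlanarEnds.gaussMap X x⟫ := fun x hx => if_neg hx
  have hu0 : ∀ i, u (p i) = 0 := fun i => if_pos (mem_range_self i)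
  have hWo : ∀ e : OpenPartialHomeomorph S ℂ, IsOpen (e.target ∩ e.symm ⁻¹' (range p)ᶜ) :=
    fun e => e.isOpen_inter_preimage_symm hP.isOpen_compl
  have hloc : ∀ e ∈ PlanarEnds.holCharts S, EqOn (u ∘ e.symm)
      (fun z => ⟪(X ∘ e.symm) z - q, PlanarEnds.unitNormal (X ∘ e.symm) z⟫)
      (e.target ∩ e.symm ⁻¹' (range p)ᶜ) := fun e he z hz => by
    have h1 := PlanarEnds.gaussMap_eq hP hM.smooth hM.conformal he (e.map_target hz.1) hz.2
    rw [e.right_inv hz.1] at h1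
    rw [Function.comp_apply, hu1 _ hz.2, h1]
    rfl
  have hc : ∀ e ∈ PlanarEnds.holCharts S, ∀ z ∈ e.target ∩ e.symm ⁻¹' (range p)ᶜ,
      PlanarEnds.IsConformalImmersionAt (X ∘ e.symm) z := fun e he z hz =>
    hM.conformal e he z hz.1 hz.2
  have hsm : PlanarEnds.IsSmoothOn u (range p)ᶜ := fun e he =>
    (((hM.smooth e he).sub contDiffOn_const).inner ℝ
      (PlanarEnds.contDiffOn_unitNormal (hWo e) (hM.smooth e he) (hc e he))).congr (hloc e he)
  have hsmu : PlanarEnds.IsSmoothOn u univ := fun e he z hz => by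
    by_cases hzP : e.symm z ∈ range p
    · obtain ⟨i, hi⟩ := hzP
      obtain ⟨U, hU, hUz, hUe⟩ := PlanarEnds.exists_support_extension hM (hX.planarEnd i)
        (hq i) he hz.1 hi.symm
      -- The value `0` assigned to `u` at the puncture agrees with `U z = 0`, so `u` and `U`
      -- coincide on a full neighbourhood.
      refine (hU.congr_of_eventuallyEq ?_).contDiffWithinAt
      rw [eventually_nhdsWithin_iff] at hUe
      filter_upwards [hUe] with w hw
      by_cases hwz : w = z
      · rw [hwz, hUz, Function.comp_apply, ← hi, hu0]
      · obtain ⟨h1, h2, h3⟩ := hw hwz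
        rw [h3, hloc e he ⟨h1, h2⟩]
    · exact ((hsm e he).contDiffAt ((hWo e).mem_nhds ⟨hz.1, hzP⟩)).contDiffWithinAt
  refine ⟨u, hu1, ⟨hsm, fun e he z hz hzP => ?_, ?_⟩, hsmu, hu0⟩
  · have h1 := PlanarEnds.jacobiOp_support_eq_zero (hWo e) (hM.smooth e he) (hc e he)
      (fun z hz => hM.minimal e he z hz.1 hz.2) q ⟨hz, hzP⟩
    rw [← h1, PlanarEnds.jacobiOp, PlanarEnds.jacobiOp,
      (InnerProductSpace.laplacian_congr_nhds
        (eventuallyEq_of_mem ((hWo e).mem_nhds ⟨hz, hzP⟩) (hloc e he))).eq_of_nhds,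
      hloc e he ⟨hz, hzP⟩]
  · obtain ⟨C, hC⟩ := isCompact_univ.exists_bound_of_continuousOn hsmu.continuous.continuousOn
    exact ⟨C, fun x _ => hC x (mem_univ x)⟩
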